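/- **Notation.** Let $\gamma$ be the Euler constant, $\lambda=e^{\tilde\lambda}$ with $\tilde\lambda\in\mathbb C$, $\log\lambda:=\tilde\lambda$, $\sqrt\lambda:=e^{\tilde\lambda/2}$, and let $\arg z\in(-\pi,\pi)$ and $\log z$ be principal for $z\in\mathbb C\setminus(-\infty,0]$. Let $$y_0(z,\lambda)=\sum_{j\ge0}\frac{\lambda^{-2j}z^{4j}}{16^j(j!)^2},\qquad y_1(z,\lambda)=-2\lambda^{-1}\sum_{j\ge1}\Bigl(1+\cdots+\frac1j\Bigr)\frac{\lambda^{-2j}z^{4j}}{16^j(j!)^2},$$ and for $a>0$, with $\sqrt{-a}=i\sqrt a$, $$\phi(z,\lambda)=\begin{pmatrix}\sqrt{-a}&-\lambda/\sqrt{-a}\\0&1/\sqrt{-a}\end{pmatrix}\begin{pmatrix}1&0\\\lambda^{-1}\log\frac z2&1\end{pmatrix}\begin{pmatrix}y_0&\lambda z(y_0)_z\\\frac14y_1&y_0+\lambda z\frac14(y_1)_z\end{pmatrix}.$$ Let $I_0$ be the modified Bessel function of the first kind and $Y_0$ the Bessel function of the second kind, regarded as functions on the universal covering of $\mathbb C^*$,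 and let $T_1,T_2$ be the functions on this covering determined by $$I_0(x)=\sqrt{\tfrac{2}{\pi x}}\,e^{-i\pi/4}\bigl\{(1+T_1(x))\cos(ix-\tfrac\pi4)-T_2(x)\sin(ix-\tfrac\pi4)\bigr\},$$ $$Y_0(ix)=\sqrt{\tfrac{2}{\pi x}}\,e^{-i\pi/4}\bigl\{(1+T_1(x))\sin(ix-\tfrac\pi4)+T_2(x)\cos(ix-\tfrac\pi4)\bigr\}.$$ For $m\in\mathbb Z$ let $\tilde\Omega_m=\{\tilde\lambda\in\mathbb C: -\frac\pi2<\operatorname{Im}\tilde\lambda<\frac32\pi\}-im\pi$. **Proposition 4.3.** Let $m\in\mathbb Z$. For every $a>0$, every $z\in\mathbb C\setminus(-\infty,0]$ and $\lambda=e^{\tilde\lambda}$ with $\tilde\lambda\in\tilde\Omega_m$, $$\phi(z,\lambda)=H(\lambda)\,A_m(\lambda)\,\phi_0(z,\lambda)\,K_m(z,\lambda)\,C(z),$$ where $$H=\begin{pmatrix}1+p&\lambda p\\-\lambda^{-1}p&1-p\end{pmatrix},\quad p=\frac1{2a}\log\lambda,\qquad \phi_0=\exp\Bigl(\lambda^{-1}\frac{z^2}2\begin{pmatrix}0&1\\1&0\end{pmatrix}\Bigr),\qquad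 C=\begin{pmatrix}z^{-1}&0\\0&z\end{pmatrix},$$ the matrix $A_m$ equals $\frac{i}{2\sqrt{2\gamma\pi}}\begin{pmatrix}\alpha_{11}&\alpha_{12}\\\alpha_{21}&\alpha_{22}\end{pmatrix}$ with $$\alpha_{11}=i^m\sqrt\lambda\Bigl\{2\Bigl(2\sqrt{\tfrac a\gamma}-\sqrt{\tfrac\gamma a}\Bigr)\gamma e^{-i\pi/4}+(\sqrt2me^{i\pi/4}-1)\sqrt{\tfrac{2\gamma}a}\,\pi\Bigr\},$$ $$\alpha_{12}=i^{-m}\sqrt\lambda\Bigl\{2\Bigl(2\sqrt{\tfrac a\gamma}-\sqrt{\tfrac\gamma a}\Bigr)\gamma e^{i\pi/4}-(\sqrt2me^{-i\pi/4}-1)\sqrt{\tfrac{2\gamma}a}\,\pi\Bigr\},$$ $$\alpha_{21}=i^m\sqrt\lambda^{-1}\bigl\{\sqrt2\gamma e^{-i\pi/4}-(\sqrt2me^{i\pi/4}-1)\pi\bigr\}\sqrt{\tfrac{2\gamma}a},$$ $$\alpha_{22}=i^{-m}\sqrt\lambda^{-1}\bigl\{\sqrt2\gamma e^{i\pi/4}+(\sqrt2me^{-i\pi/4}-1)\pi\bigr\}\sqrt{\tfrac{2\gamma}a},$$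 and, with $T_k=T_k\bigl(\lambda^{-1}\frac{z^2}2e^{-im\pi}\bigr)$ evaluated at the point of the covering with argument $2\arg z-\operatorname{Im}\tilde\lambda-m\pi$, $$K_m=\begin{pmatrix}1+T_1&(-1)^{m+1}iT_2+\lambda\,(z^{-1}+z^{-1}T_1)_z\\(-1)^{m+1}iT_2&1+T_1+\lambda(-1)^{m+1}i\,(z^{-1}T_2)_z\end{pmatrix}.$$ Moreover $K_m\to\mathrm{Id}$ as $\lambda^{-1}z^2\to\infty$ in the sector $-\frac32\pi<\arg(\lambda^{-1}z^2e^{-im\pi})<\frac\pi2$, with $K_m=\mathrm{Id}+O\bigl((\lambda^{-1}z^2)^{-1}\bigr)$, uniformly on closed subsectors: for every $\delta>0$ both hold as $|\lambda^{-1}z^2|\to\infty$ over all $z\in\mathbb C\setminus(-\infty,0]$, $\tilde\lambda\in\tilde\Omega_m$ with $-\frac32\pi+\delta\le2\arg z-\operatorname{Im}\tilde\lambda-m\pi\le\frac\pi2-\delta$. -/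

import Mathlib

namespace Smyth

section

open Complex

/-- The modified Bessel function of the first kind of order zero,
`I₀(x) = ∑ (x/2)^(2j) / (j!)²`. -/
noncomputable def besselI0 (x : ℂ) : ℂ :=
  ∑' j : ℕ, (x / 2) ^ (2 * j) / ((j.factorial : ℂ)) ^ 2

/-- The Bessel function of the first kind of order zero,
`J₀(w) = ∑ (-1)^j (w/2)^(2j) / (j!)²`. -/
noncomputable def besselJ0 (w : ℂ) : ℂ :=
  ∑' j : ℕ, (-1) ^ j * (w / 2) ^ (2 * j) / ((j.factorial : ℂ)) ^ 2

/-- The Bessel function of the second kind of order zero, `Y₀(w)`, as a single-valued function of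
the logarithmic coordinate `η` (so `w = e^η`, and `log (w/2)` is `η - log 2`):
`Y₀(w) = (2/π) { (log (w/2) + γ) J₀(w) + ∑_{j ≥ 1} (-1)^(j+1) (1 + ⋯ + 1/j) (w/2)^(2j) / (j!)² }`.
The term `j = 0` of the sum vanishes because `harmonic 0 = 0`. -/
noncomputable def besselY0 (η : ℂ) : ℂ :=
  2 / (Real.pi : ℂ) *
    ((η - (Real.log 2 : ℂ) + (Real.eulerMascheroniConstant : ℂ)) * besselJ0 (exp η) +
      ∑' j : ℕ, (-1) ^ (j + 1) * ((harmonic j : ℚ) : ℂ) * (exp η / 2) ^ (2 * j) /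
        ((j.factorial : ℂ)) ^ 2)

/-- The remainder `T₁(x)` of the large argument expansion of `I₀(x)` and `Y₀(ix)`, as a function of
the logarithmic coordinate `ξ` of `x = e^ξ` (`ix` has logarithmic coordinate `ξ + iπ/2` and
`√x = e^{ξ/2}`). The pair `T₁, T₂` is the unique pair for which `besselI0_eq` and `besselY0_eq`
below hold (the rotation matrix in these two formulas is invertible). -/
noncomputable def T1 (ξ : ℂ) : ℂ :=
  (Real.sqrt (Real.pi / 2) : ℂ) * exp (ξ / 2) * exp (I * (Real.pi / 4)) *
    (cos (I * exp ξ - Real.pi / 4) * besselI0 (exp ξ) +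
      sin (I * exp ξ - Real.pi / 4) * besselY0 (ξ + I * (Real.pi / 2))) - 1

/-- The remainder `T₂(x)`, `x = e^ξ`; see `T1`. -/
noncomputable def T2 (ξ : ℂ) : ℂ :=
  (Real.sqrt (Real.pi / 2) : ℂ) * exp (ξ / 2) * exp (I * (Real.pi / 4)) *
    (-sin (I * exp ξ - Real.pi / 4) * besselI0 (exp ξ) +
      cos (I * exp ξ - Real.pi / 4) * besselY0 (ξ + I * (Real.pi / 2)))

/-- Auxiliary cancellation of the scalar prefactors. -/
theorem prefactor_mul (ξ : ℂ) :
    ((Real.sqrt (2 / Real.pi) : ℂ) * exp (-(ξ / 2)) * exp (-(I * (Real.pi / 4)))) *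
      ((Real.sqrt (Real.pi / 2) : ℂ) * exp (ξ / 2) * exp (I * (Real.pi / 4))) = 1 := by
  have h1 : Real.sqrt (2 / Real.pi) * Real.sqrt (Real.pi / 2) = 1 := by
    rw [← Real.sqrt_mul (by positivity)]
    rw [div_mul_div_cancel₀ Real.pi_pos.ne', div_self two_ne_zero, Real.sqrt_one]
  have h1' : (Real.sqrt (2 / Real.pi) : ℂ) * (Real.sqrt (Real.pi / 2) : ℂ) = 1 := by
    exact_mod_cast h1
  have h2 : exp (-(ξ / 2)) * exp (ξ / 2) = 1 := by rw [← exp_add]; simp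
  have h3 : exp (-(I * ((Real.pi : ℂ) / 4))) * exp (I * ((Real.pi : ℂ) / 4)) = 1 := by
    rw [← exp_add]; simp
  linear_combination (exp (-(ξ / 2)) * exp (ξ / 2)) *
      (exp (-(I * ((Real.pi : ℂ) / 4))) * exp (I * ((Real.pi : ℂ) / 4))) * h1' +
    (exp (-(I * ((Real.pi : ℂ) / 4))) * exp (I * ((Real.pi : ℂ) / 4))) * h2 + h3

/-- `I₀(x) = √(2/(πx)) e^{-iπ/4} { (1 + T₁(x)) cos(ix - π/4) - T₂(x) sin(ix - π/4) }`. -/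
theorem besselI0_eq (ξ : ℂ) :
    besselI0 (exp ξ) =
      (Real.sqrt (2 / Real.pi) : ℂ) * exp (-(ξ / 2)) * exp (-(I * (Real.pi / 4))) *
        ((1 + T1 ξ) * cos (I * exp ξ - Real.pi / 4) - T2 ξ * sin (I * exp ξ - Real.pi / 4)) := by
  have h := prefactor_mul ξ
  have hs := sin_sq_add_cos_sq (I * exp ξ - Real.pi / 4)
  unfold T1 T2
  linear_combination (-besselI0 (exp ξ)) * h -
    ((Real.sqrt (2 / Real.pi) : ℂ) * exp (-(ξ / 2)) * exp (-(I * (Real.pi / 4)))) *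
      ((Real.sqrt (Real.pi / 2) : ℂ) * exp (ξ / 2) * exp (I * (Real.pi / 4))) *
      besselI0 (exp ξ) * hs

/-- `Y₀(ix) = √(2/(πx)) e^{-iπ/4} { (1 + T₁(x)) sin(ix - π/4) + T₂(x) cos(ix - π/4) }`. -/
theorem besselY0_eq (ξ : ℂ) :
    besselY0 (ξ + I * (Real.pi / 2)) =
      (Real.sqrt (2 / Real.pi) : ℂ) * exp (-(ξ / 2)) * exp (-(I * (Real.pi / 4))) *
        ((1 + T1 ξ) * sin (I * exp ξ - Real.pi / 4) + T2 ξ * cos (I * exp ξ - Real.pi / 4)) := by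
  have h := prefactor_mul ξ
  have hs := sin_sq_add_cos_sq (I * exp ξ - Real.pi / 4)
  unfold T1 T2
  linear_combination (-besselY0 (ξ + I * (Real.pi / 2))) * h -
    ((Real.sqrt (2 / Real.pi) : ℂ) * exp (-(ξ / 2)) * exp (-(I * (Real.pi / 4)))) *
      ((Real.sqrt (Real.pi / 2) : ℂ) * exp (ξ / 2) * exp (I * (Real.pi / 4))) *
      besselY0 (ξ + I * (Real.pi / 2)) * hs

/-- `y₀(z,λ) = ∑_{j ≥ 0} λ^(-2j) z^(4j) / (16^j (j!)²)`. -/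
noncomputable def y0 (z lam : ℂ) : ℂ :=
  ∑' j : ℕ, lam⁻¹ ^ (2 * j) * z ^ (4 * j) / (16 ^ j * ((j.factorial : ℂ)) ^ 2)

/-- `y₁(z,λ) = -2 λ⁻¹ ∑_{j ≥ 1} (1 + ⋯ + 1/j) λ^(-2j) z^(4j) / (16^j (j!)²)`
(the term `j = 0` vanishes). -/
noncomputable def y1 (z lam : ℂ) : ℂ :=
  -2 * lam⁻¹ * ∑' j : ℕ, ((harmonic j : ℚ) : ℂ) *
    (lam⁻¹ ^ (2 * j) * z ^ (4 * j) / (16 ^ j * ((j.factorial : ℂ)) ^ 2))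

/-- The canonical solution `L` of `L⁻¹ dL = λ⁻¹ [[0, z³], [z⁻¹, 0]] dz`. -/
noncomputable def L (z lam : ℂ) : Matrix (Fin 2) (Fin 2) ℂ :=
  !![1, 0; lam⁻¹ * log (z / 2), 1] *
    !![y0 z lam, lam * z * deriv (fun w => y0 w lam) z;
       (1 / 4) * y1 z lam, y0 z lam + lam * z * ((1 / 4) * deriv (fun w => y1 w lam) z)]

/-- The dressed solution `φ`, with `√(-a) = i √a` for `a > 0`. -/
noncomputable def phi (a : ℝ) (z lam : ℂ) : Matrix (Fin 2) (Fin 2) ℂ :=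
  !![I * (Real.sqrt a : ℂ), -lam / (I * (Real.sqrt a : ℂ)); 0, 1 / (I * (Real.sqrt a : ℂ))] *
    L z lam

/-- The strip `Ω̃_m = { -π/2 < Im < 3π/2 } - imπ`. -/
def Omega (m : ℤ) : Set ℂ :=
  {l | -(Real.pi / 2) < (l + I * m * Real.pi).im ∧ (l + I * m * Real.pi).im < 3 / 2 * Real.pi}

/-- The matrix `H(λ)`, with `p = log λ / (2a)` and `log λ` the coordinate `l` on the universal
covering `l ↦ e^l = λ` of `ℂ*`. -/
noncomputable def H (a : ℝ) (l : ℂ) : Matrix (Fin 2) (Fin 2) ℂ :=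
  !![1 + l / (2 * a), exp l * (l / (2 * a)); -(exp l)⁻¹ * (l / (2 * a)), 1 - l / (2 * a)]

/-- The explicit matrix `A_m(λ)`, with `λ = e^l`, `√λ = e^{l/2}` and `γ` the Euler constant. -/
noncomputable def A (a : ℝ) (m : ℤ) (l : ℂ) : Matrix (Fin 2) (Fin 2) ℂ :=
  let γ : ℝ := Real.eulerMascheroniConstant
  let e : ℂ := exp (I * (Real.pi / 4))
  let e' : ℂ := exp (-(I * (Real.pi / 4)))
  let r : ℂ := exp (l / 2)
  let s2 : ℂ := (Real.sqrt 2 : ℂ)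
  let q : ℂ := (Real.sqrt (2 * γ / a) : ℂ)
  let d : ℂ := 2 * (2 * (Real.sqrt (a / γ) : ℂ) - (Real.sqrt (γ / a) : ℂ)) * γ
  (I / (2 * (Real.sqrt (2 * γ * Real.pi) : ℂ))) •
    !![I ^ m * r * (d * e' + (s2 * m * e - 1) * q * Real.pi),
       I ^ (-m) * r * (d * e - (s2 * m * e' - 1) * q * Real.pi);
       I ^ m * r⁻¹ * (s2 * γ * e' - (s2 * m * e - 1) * Real.pi) * q,
       I ^ (-m) * r⁻¹ * (s2 * γ * e + (s2 * m * e' - 1) * Real.pi) * q]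

/-- `φ₀(z,λ) = exp (λ⁻¹ (z²/2) [[0, 1], [1, 0]])` (matrix exponential), `λ = e^l`. -/
noncomputable def phi0 (z l : ℂ) : Matrix (Fin 2) (Fin 2) ℂ :=
  NormedSpace.exp (((exp l)⁻¹ * (z ^ 2 / 2)) • (!![0, 1; 1, 0] : Matrix (Fin 2) (Fin 2) ℂ))

/-- The logarithmic coordinate of `λ⁻¹ (z²/2) e^{-imπ}`, for `λ = e^l` and `z ∉ (-∞, 0]`. -/
noncomputable def xi (m : ℤ) (z l : ℂ) : ℂ :=
  2 * log z - (Real.log 2 : ℂ) - l - I * m * Real.pi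

/-- The matrix `K_m(z,λ)`, `λ = e^l`, with derivatives taken in `z`. -/
noncomputable def K (m : ℤ) (z l : ℂ) : Matrix (Fin 2) (Fin 2) ℂ :=
  !![1 + T1 (xi m z l),
     (-1) ^ (m + 1) * I * T2 (xi m z l) +
       exp l * deriv (fun w => w⁻¹ + w⁻¹ * T1 (xi m w l)) z;
     (-1) ^ (m + 1) * I * T2 (xi m z l),
     1 + T1 (xi m z l) +
       exp l * (-1) ^ (m + 1) * I * deriv (fun w => w⁻¹ * T2 (xi m w l)) z]

/-- `C(z) = diag(z⁻¹, z)`. -/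
noncomputable def C (z : ℂ) : Matrix (Fin 2) (Fin 2) ℂ := !![z⁻¹, 0; 0, z]

/-- The pairs `(z, l)` with `z ∉ (-∞, 0]`, `l ∈ Ω̃_m` and
`-3π/2 + δ ≤ arg (λ⁻¹ z² e^{-imπ}) ≤ π/2 - δ`, where the argument is the imaginary part
`2 arg z - Im l - mπ` of the logarithmic coordinate. -/
def closedSector (m : ℤ) (δ : ℝ) : Set (ℂ × ℂ) :=
  {p | p.1 ∈ slitPlane ∧ p.2 ∈ Omega m ∧
    -(3 / 2 * Real.pi) + δ ≤ 2 * arg p.1 - p.2.im - m * Real.pi ∧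
    2 * arg p.1 - p.2.im - m * Real.pi ≤ Real.pi / 2 - δ}

/-- The filter `λ⁻¹ z² → ∞` within the closed subsector of opening parameter `δ`. -/
noncomputable def atInftySector (m : ℤ) (δ : ℝ) : Filter (ℂ × ℂ) :=
  Filter.comap (fun p : ℂ × ℂ => ‖(exp p.2)⁻¹ * p.1 ^ 2‖) Filter.atTop ⊓
    Filter.principal (closedSector m δ)

end

end Smyth

/-!
Everything is expressed through the logarithmic coordinate `ξ` of `x = e ^ ξ`, in which `I₀` (`logI`)
and `K₀` (`logK`) are entire and satisfy `f'' = e ^ (2 ξ) f`. The combinations `1 + T₁ ± i T₂` are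
Hankel functions of `i x` stripped of their exponentials: they equal `normK ξ` and `normK (ξ + i π)`,
where `normK ξ = √(2 / π) √x e ^ x K₀(x)` (`one_add_T1_add_I_mul_T2`, `one_add_T1_sub_I_mul_T2`).

The factorisation of `φ`. The first column of `φ₀ K C` contains only `e ^ x (1 + T₁ - i T₂)` and
`e ^ (-x) (1 + T₁ + i T₂)`, so it is a constant combination of `K₀` and `I₀`. So is the first column of
`φ`, the logarithm `log (z / 2)` being absorbed into `K₀`, and the two are compared by algebra
(`phi_fst_col_upper`, `phi_fst_col_lower`). The second columns are `λ z ∂_z` of the first ones; this is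
what the derivatives in `K` are for (`phi_eq`).

The asymptotics. It has to be shown that `normK = 1 + O(1 / x)` for `|arg x| ≤ 3π / 2 - δ`. For `x > 0`
the function `K₀` equals `∫ e ^ (-x (s + 1)) / √(s (s + 2)) ds`: both solve the modified Bessel equation
and behave like `-log (x / 2) - γ` at the origin, the constant in the integral being `Γ'(1)`
(`tendsto_realK_add_log`), and a solution that vanishes at the origin is zero by a Wronskian argument
(`eventually_eq_zero_of_tendsto`). The substitution `u = x s` turns `√x e ^ x K₀(x)` into
`∫ e ^ (-u) u ^ (-1 / 2) (2 + u / x) ^ (-1 / 2) du`, which may be taken along any ray `arg u = θ` with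
`|θ| < π / 2` and then continues `K₀` to `|arg x - θ| < π` (`scaledK_eq_rayInt`). There the estimate is
immediate, and two values of `θ` cover the sector (`exists_norm_normK_sub_le`). This bounds `T₁` and
`T₂`, Cauchy's estimate in `ξ` bounds their derivatives, and `K - 1 = O((λ⁻¹ z ^ 2)⁻¹)` follows.
-/

/-! ### The Bessel functions in the logarithmic coordinate -/

namespace Smyth

open Complex Filter Topology

/-- Coefficient sequences `c` for which `∑ c j * q ^ j` converges absolutely for every `q`. -/
def EntireCoeff (c : ℕ → ℂ) : Prop := ∀ R : ℝ, 0 < R → Summable fun j => ‖c j‖ * R ^ j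

/-- The power series `∑ c j * x ^ (2 * j)` in the logarithmic coordinate `ξ` of `x = e ^ ξ`. -/
noncomputable def expSeries (c : ℕ → ℂ) (ξ : ℂ) : ℂ := ∑' j : ℕ, c j * exp (2 * j * ξ)

theorem EntireCoeff.summable {c : ℕ → ℂ} (hc : EntireCoeff c) (ξ : ℂ) :
    Summable fun j : ℕ => c j * exp (2 * j * ξ) := by
  refine .of_norm_bounded (hc (Real.exp (2 * ξ.re)) (Real.exp_pos _)) fun j => ?_
  rw [norm_mul, norm_exp, ← Real.exp_nat_mul]
  refine le_of_eq ?_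
  congr 2
  simp
  ring

theorem EntireCoeff.natCast_mul {c : ℕ → ℂ} (hc : EntireCoeff c) :
    EntireCoeff fun j => 2 * j * c j := by
  intro R hR
  refine .of_nonneg_of_le (fun j => by positivity) (fun j => ?_)
    ((hc (2 * R) (by positivity)).mul_left 2)
  have hj : (j : ℝ) ≤ 2 ^ j := by exact_mod_cast Nat.lt_two_pow_self.le
  rw [norm_mul, norm_mul, norm_natCast, norm_ofNat, mul_pow]
  calc 2 * (j : ℝ) * ‖c j‖ * R ^ j = (j : ℝ) * (2 * ‖c j‖ * R ^ j) := by ring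
    _ ≤ 2 ^ j * (2 * ‖c j‖ * R ^ j) := by gcongr
    _ = _ := by ring

theorem EntireCoeff.hasDerivAt {c : ℕ → ℂ} (hc : EntireCoeff c) (ξ : ℂ) :
    HasDerivAt (expSeries c) (expSeries (fun j => 2 * j * c j) ξ) ξ := by
  have hU : IsOpen {w : ℂ | w.re < ξ.re + 1} := isOpen_lt continuous_re continuous_const
  have hu := hc (Real.exp (2 * (ξ.re + 1))) (Real.exp_pos _)
  have hf : ∀ j : ℕ, DifferentiableOn ℂ (fun w => c j * exp (2 * j * w))
      {w : ℂ | w.re < ξ.re + 1} := fun j => by fun_prop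
  have hle : ∀ (j : ℕ) (w : ℂ), w ∈ {w : ℂ | w.re < ξ.re + 1} →
      ‖c j * exp (2 * j * w)‖ ≤ ‖c j‖ * Real.exp (2 * (ξ.re + 1)) ^ j := by
    intro j w hw
    rw [norm_mul, norm_exp, ← Real.exp_nat_mul]
    gcongr
    have : (2 * (j : ℂ) * w).re = j * (2 * w.re) := by simp; ring
    rw [this]
    gcongr
    exact le_of_lt hw
  have hξ : ξ ∈ {w : ℂ | w.re < ξ.re + 1} := by simp
  have hd := (differentiableOn_tsum_of_summable_norm hu hf hU hle).differentiableAt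
    (hU.mem_nhds hξ)
  have hs := hasSum_deriv_of_summable_norm hu hf hU hle hξ
  have : expSeries (fun j => 2 * j * c j) ξ = deriv (expSeries c) ξ := by
    unfold expSeries
    rw [← hs.tsum_eq]
    refine tsum_congr fun j => ?_
    have h : HasDerivAt (fun w => c j * exp (2 * j * w)) (c j * (exp (2 * j * ξ) * (2 * j * 1))) ξ :=
      (((hasDerivAt_id ξ).const_mul (2 * (j : ℂ))).cexp).const_mul (c j)
    rw [h.deriv]
    ring
  rw [this]
  exact hd.hasDerivAt

/-- Shifting the index of an `expSeries` whose constant term vanishes. -/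
theorem EntireCoeff.expSeries_eq_exp_mul {c d : ℕ → ℂ} (hc : EntireCoeff c) (h0 : c 0 = 0)
    (hd : ∀ j, c (j + 1) = d j) (ξ : ℂ) : expSeries c ξ = exp (2 * ξ) * expSeries d ξ := by
  unfold expSeries
  rw [(hc.summable ξ).tsum_eq_zero_add, h0, zero_mul, zero_add, ← tsum_mul_left]
  refine tsum_congr fun j => ?_
  rw [hd]
  have : exp (2 * ((j + 1 : ℕ) : ℂ) * ξ) = exp (2 * ξ) * exp (2 * j * ξ) := by
    rw [← exp_add]; push_cast; ring_nf
  rw [this]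
  ring

/-- Taylor coefficients of `I₀` in `x ^ 2`. -/
noncomputable def coeffI (j : ℕ) : ℂ := 1 / (4 ^ j * (j.factorial : ℂ) ^ 2)

/-- Taylor coefficients in `x ^ 2` of the holomorphic part of `K₀`. -/
noncomputable def coeffS (j : ℕ) : ℂ := ((harmonic j : ℚ) : ℂ) * coeffI j

theorem norm_coeffI (j : ℕ) : ‖coeffI j‖ = 1 / (4 ^ j * (j.factorial : ℝ) ^ 2) := by
  simp [coeffI]

theorem entireCoeff_of_norm_le {c : ℕ → ℂ} (h : ∀ j, ‖c j‖ ≤ 1 / (j.factorial : ℝ)) :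
    EntireCoeff c := by
  intro R hR
  refine .of_nonneg_of_le (fun j => by positivity) (fun j => ?_) (Real.summable_pow_div_factorial R)
  calc ‖c j‖ * R ^ j ≤ 1 / (j.factorial : ℝ) * R ^ j := by gcongr; exact h j
    _ = _ := by ring

theorem entireCoeff_coeffI : EntireCoeff coeffI := by
  refine entireCoeff_of_norm_le fun j => ?_
  rw [norm_coeffI]
  have h1 : (1 : ℝ) ≤ j.factorial := by exact_mod_cast j.factorial_pos
  have h4 : (1 : ℝ) ≤ 4 ^ j := one_le_pow₀ (by norm_num)
  gcongr
  nlinarith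

theorem harmonic_le_natCast (j : ℕ) : harmonic j ≤ j := by
  induction j with
  | zero => simp
  | succ n ih =>
    rw [harmonic_succ]
    push_cast
    have : ((n : ℚ) + 1)⁻¹ ≤ 1 := inv_le_one_of_one_le₀ (by linarith [Nat.cast_nonneg (α := ℚ) n])
    linarith

theorem harmonic_nonneg (j : ℕ) : 0 ≤ harmonic j :=
  Finset.sum_nonneg fun i _ => by positivity

theorem entireCoeff_coeffS : EntireCoeff coeffS := by
  refine entireCoeff_of_norm_le fun j => ?_
  -- The factor `4 ^ j` in the denominator of `coeffI` absorbs the harmonic number.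
  have hh : ‖((harmonic j : ℚ) : ℂ)‖ ≤ 4 ^ j := by
    have h1 : ‖((harmonic j : ℚ) : ℂ)‖ = ((harmonic j : ℚ) : ℝ) := by
      have : ((harmonic j : ℚ) : ℂ) = (((harmonic j : ℚ) : ℝ) : ℂ) := by simp
      rw [this, norm_real, Real.norm_of_nonneg (by exact_mod_cast harmonic_nonneg j)]
    rw [h1]
    have h2 : ((harmonic j : ℚ) : ℝ) ≤ j := by exact_mod_cast harmonic_le_natCast j
    have h3 : (j : ℝ) ≤ 4 ^ j := by exact_mod_cast (Nat.lt_pow_self (by norm_num)).le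
    exact h2.trans h3
  have h1 : (1 : ℝ) ≤ j.factorial := by exact_mod_cast j.factorial_pos
  rw [coeffS, norm_mul, norm_coeffI]
  calc _ ≤ 4 ^ j * (1 / (4 ^ j * (j.factorial : ℝ) ^ 2)) := by gcongr
    _ = 1 / (j.factorial : ℝ) ^ 2 := by field_simp
    _ ≤ _ := by gcongr; nlinarith

/-- The recurrence of the coefficients that encodes the modified Bessel equation. -/
theorem coeffI_succ (j : ℕ) : (2 * (j + 1 : ℂ)) ^ 2 * coeffI (j + 1) = coeffI j := by
  have h1 : (j.factorial : ℂ) ≠ 0 := by exact_mod_cast j.factorial_ne_zero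
  have h2 : (j + 1 : ℂ) ≠ 0 := by exact_mod_cast j.succ_ne_zero
  simp only [coeffI, Nat.factorial_succ]
  push_cast
  field_simp
  ring

theorem coeffS_succ (j : ℕ) :
    (2 * (j + 1 : ℂ)) ^ 2 * coeffS (j + 1) = coeffS j + 4 * (j + 1) * coeffI (j + 1) := by
  have h2 : (j + 1 : ℂ) ≠ 0 := by exact_mod_cast j.succ_ne_zero
  rw [coeffS, coeffS, ← coeffI_succ j, harmonic_succ]
  push_cast
  field_simp
  ring

/-- `I₀(e ^ ξ)`. -/
noncomputable def logI (ξ : ℂ) : ℂ := expSeries coeffI ξ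

/-- The modified Bessel function of the second kind `K₀(e ^ ξ)`, as an entire function of the
logarithmic coordinate `ξ`, defined by
`K₀(x) = -(log (x / 2) + γ) I₀(x) + ∑ (1 + ⋯ + 1 / j) (x / 2) ^ (2 j) / (j!) ^ 2`. -/
noncomputable def logK (ξ : ℂ) : ℂ :=
  -(ξ - (Real.log 2 : ℂ) + (Real.eulerMascheroniConstant : ℂ)) * logI ξ + expSeries coeffS ξ

theorem besselI0_exp (ξ : ℂ) : besselI0 (exp ξ) = logI ξ := by
  unfold besselI0 logI expSeries
  refine tsum_congr fun j => ?_
  have : exp (2 * j * ξ) = exp ξ ^ (2 * j) := by rw [← exp_nat_mul]; push_cast; ring_nf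
  rw [this, coeffI, div_pow, pow_mul 2]
  norm_num
  ring

theorem exp_add_I_mul_pi_div_two (ξ : ℂ) : exp (ξ + I * (Real.pi / 2)) = I * exp ξ := by
  rw [exp_add, mul_comm I, exp_pi_div_two_mul_I, mul_comm]

theorem exp_add_I_mul_pi (ξ : ℂ) : exp (ξ + I * Real.pi) = -exp ξ := by
  rw [exp_add, mul_comm I, exp_pi_mul_I]; ring

/-- `Y₀(i x) = i I₀(x) - (2 / π) K₀(x)`. -/
theorem besselY0_log (ξ : ℂ) :
    besselY0 (ξ + I * (Real.pi / 2)) = I * logI ξ - 2 / Real.pi * logK ξ := by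
  have hpi : (Real.pi : ℂ) ≠ 0 := by exact_mod_cast Real.pi_ne_zero
  have hpow : ∀ j : ℕ, (I * exp ξ / 2) ^ (2 * j) = (-1) ^ j * (exp (2 * j * ξ) / 4 ^ j) := by
    intro j
    have : exp (2 * j * ξ) = exp ξ ^ (2 * j) := by rw [← exp_nat_mul]; push_cast; ring_nf
    rw [this, div_pow, mul_pow, pow_mul I, pow_mul 2, I_sq]
    norm_num
    ring
  have hsq : ∀ j : ℕ, ((-1 : ℂ) ^ j) * (-1) ^ j = 1 := fun j => by
    rw [← mul_pow]; norm_num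
  have hJ : besselJ0 (I * exp ξ) = logI ξ := by
    unfold besselJ0 logI expSeries
    refine tsum_congr fun j => ?_
    rw [hpow, coeffI]
    linear_combination (exp (2 * j * ξ) / 4 ^ j / (j.factorial : ℂ) ^ 2) * hsq j
  have hS : ∑' j : ℕ, (-1) ^ (j + 1) * ((harmonic j : ℚ) : ℂ) * (I * exp ξ / 2) ^ (2 * j) /
        ((j.factorial : ℂ)) ^ 2 = -expSeries coeffS ξ := by
    unfold expSeries
    rw [← tsum_neg]
    refine tsum_congr fun j => ?_
    rw [hpow, coeffS, coeffI]
    linear_combination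
      (-((harmonic j : ℚ) : ℂ) * exp (2 * j * ξ) / 4 ^ j / (j.factorial : ℂ) ^ 2) * hsq j
  unfold besselY0 logK
  rw [exp_add_I_mul_pi_div_two, hJ, hS]
  field_simp
  ring

theorem expSeries_add_I_mul_pi (c : ℕ → ℂ) (ξ : ℂ) :
    expSeries c (ξ + I * Real.pi) = expSeries c ξ := by
  unfold expSeries
  refine tsum_congr fun j => ?_
  congr 1
  rw [exp_eq_exp_iff_exists_int]
  exact ⟨j, by push_cast; ring⟩

/-- The monodromy of `K₀` about the origin. -/
theorem logK_add_I_mul_pi (ξ : ℂ) :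
    logK (ξ + I * Real.pi) = logK ξ - I * Real.pi * logI ξ := by
  unfold logK logI
  rw [expSeries_add_I_mul_pi, expSeries_add_I_mul_pi]
  ring

theorem hasDerivAt_logI (ξ : ℂ) :
    HasDerivAt logI (expSeries (fun j => 2 * j * coeffI j) ξ) ξ :=
  entireCoeff_coeffI.hasDerivAt ξ

theorem differentiable_logI : Differentiable ℂ logI := fun ξ => (hasDerivAt_logI ξ).differentiableAt

/-- The derivative of `K₀` with respect to `ξ`; the term `-logI ξ` comes from the logarithm. -/
theorem hasDerivAt_logK (ξ : ℂ) :
    HasDerivAt logK (-logI ξ - (ξ - (Real.log 2 : ℂ) + (Real.eulerMascheroniConstant : ℂ)) *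
      expSeries (fun j => 2 * j * coeffI j) ξ + expSeries (fun j => 2 * j * coeffS j) ξ) ξ := by
  have h1 : HasDerivAt (fun w : ℂ => -(w - (Real.log 2 : ℂ) +
      (Real.eulerMascheroniConstant : ℂ))) (-1) ξ :=
    (((hasDerivAt_id ξ).sub_const _).add_const _).neg
  refine ((h1.mul (hasDerivAt_logI ξ)).add (entireCoeff_coeffS.hasDerivAt ξ)).congr_deriv ?_
  ring

theorem differentiable_logK : Differentiable ℂ logK := fun ξ => (hasDerivAt_logK ξ).differentiableAt

/-- The modified Bessel equation for `I₀`; in the coordinate `ξ` it reads `f'' = e ^ (2 ξ) f`. -/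
theorem hasDerivAt_deriv_logI (ξ : ℂ) : HasDerivAt (deriv logI) (exp (2 * ξ) * logI ξ) ξ := by
  have h : deriv logI = expSeries fun j => 2 * j * coeffI j :=
    funext fun w => (hasDerivAt_logI w).deriv
  rw [h]
  convert entireCoeff_coeffI.natCast_mul.hasDerivAt ξ using 1
  refine (entireCoeff_coeffI.natCast_mul.natCast_mul.expSeries_eq_exp_mul (by simp)
    (fun j => ?_) ξ).symm
  rw [← coeffI_succ j]
  push_cast
  ring

/-- The modified Bessel equation for `K₀`. -/
theorem hasDerivAt_deriv_logK (ξ : ℂ) : HasDerivAt (deriv logK) (exp (2 * ξ) * logK ξ) ξ := by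
  have h : deriv logK = fun w => -logI w -
      (w - (Real.log 2 : ℂ) + (Real.eulerMascheroniConstant : ℂ)) *
        expSeries (fun j => 2 * j * coeffI j) w + expSeries (fun j => 2 * j * coeffS j) w :=
    funext fun w => (hasDerivAt_logK w).deriv
  rw [h]
  have h1 : HasDerivAt (fun w : ℂ => (w - (Real.log 2 : ℂ) +
      (Real.eulerMascheroniConstant : ℂ))) 1 ξ :=
    (((hasDerivAt_id ξ).sub_const _).add_const _)
  have hI := entireCoeff_coeffI.natCast_mul.hasDerivAt ξ
  have hS := entireCoeff_coeffS.natCast_mul.hasDerivAt ξ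
  refine (((hasDerivAt_logI ξ).neg.sub (h1.mul hI)).add hS).congr_deriv ?_
  have eI : expSeries (fun j => 2 * j * (2 * j * coeffI j)) ξ = exp (2 * ξ) * logI ξ :=
    entireCoeff_coeffI.natCast_mul.natCast_mul.expSeries_eq_exp_mul (by simp)
      (fun j => by rw [← coeffI_succ j]; push_cast; ring) ξ
  have eS : expSeries (fun j => 2 * j * (2 * j * coeffS j)) ξ =
      exp (2 * ξ) * expSeries coeffS ξ + 2 * expSeries (fun j => 2 * j * coeffI j) ξ := by
    have hc : EntireCoeff fun j : ℕ => 2 * j * (2 * j * coeffS j) - 2 * (2 * j * coeffI j) := by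
      intro R hR
      refine .of_nonneg_of_le (fun j => by positivity) (fun j => ?_)
        ((entireCoeff_coeffS.natCast_mul.natCast_mul R hR).add
          ((entireCoeff_coeffI.natCast_mul R hR).mul_left 2))
      rw [← mul_assoc, ← add_mul]
      gcongr
      refine (norm_sub_le _ _).trans (add_le_add le_rfl ?_)
      rw [norm_mul, norm_ofNat]
    rw [← hc.expSeries_eq_exp_mul (d := coeffS) (by simp) (fun j => ?_) ξ]
    · unfold expSeries
      rw [← tsum_mul_left, ← (hc.summable ξ).tsum_add
        ((entireCoeff_coeffI.natCast_mul.summable ξ).mul_left 2)]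
      refine tsum_congr fun j => ?_
      ring
    · push_cast
      linear_combination coeffS_succ j
  rw [eI, eS, logK]
  ring

/-- The normalised function `√(2 / π) √x e ^ x K₀(x)`, which tends to `1` at infinity in the sector
`|arg x| < 3π / 2`. -/
noncomputable def normK (ξ : ℂ) : ℂ :=
  (Real.sqrt (2 / Real.pi) : ℂ) * exp (ξ / 2) * exp (exp ξ) * logK ξ

theorem differentiable_normK : Differentiable ℂ normK := by
  unfold normK
  have := differentiable_logK
  fun_prop

theorem sqrt_pi_div_two : (Real.sqrt (Real.pi / 2) : ℂ) = Real.pi / 2 * Real.sqrt (2 / Real.pi) := by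
  have h : Real.sqrt (Real.pi / 2) = Real.pi / 2 * Real.sqrt (2 / Real.pi) := by
    rw [show Real.pi / 2 * Real.sqrt (2 / Real.pi) =
      Real.sqrt ((Real.pi / 2) ^ 2) * Real.sqrt (2 / Real.pi) by
        rw [Real.sqrt_sq (by positivity)], ← Real.sqrt_mul (by positivity)]
    congr 1
    field_simp
  exact_mod_cast h

theorem exp_I_mul_pi_div_four_sq : exp (I * (Real.pi / 4)) ^ 2 = I := by
  rw [← exp_nat_mul]
  have : ((2 : ℕ) : ℂ) * (I * (Real.pi / 4)) = Real.pi / 2 * I := by push_cast; ring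
  rw [this, exp_pi_div_two_mul_I]

/-- With `w = i x`, the combination `1 + T₁ + i T₂` is `√(π w / 2) e ^ (-i (w - π / 4))` times the
Hankel function `J₀(w) + i Y₀(w)`, that is, a normalised `K₀(x)`. -/
theorem one_add_T1_add_I_mul_T2 (ξ : ℂ) : 1 + T1 ξ + I * T2 ξ = normK ξ := by
  have hpi : (Real.pi : ℂ) ≠ 0 := by exact_mod_cast Real.pi_ne_zero
  have hexp : cos (I * exp ξ - Real.pi / 4) - I * sin (I * exp ξ - Real.pi / 4) =
      exp (exp ξ) * exp (I * (Real.pi / 4)) := by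
    rw [← exp_add, mul_comm I (sin _), ← cos_neg, sub_eq_add_neg (cos _), ← neg_mul, ← sin_neg,
      ← exp_mul_I]
    congr 1
    linear_combination (-exp ξ) * I_sq
  unfold T1 T2
  rw [besselI0_exp, besselY0_log, sqrt_pi_div_two, normK]
  set c := cos (I * exp ξ - Real.pi / 4)
  set s := sin (I * exp ξ - Real.pi / 4)
  set e := exp (I * ((Real.pi : ℂ) / 4)) with he
  have h2 : e ^ 2 = I := exp_I_mul_pi_div_four_sq
  have key : (c * logI ξ + s * (I * logI ξ - 2 / Real.pi * logK ξ)) +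
      I * (-s * logI ξ + c * (I * logI ξ - 2 / Real.pi * logK ξ)) =
      -(2 / Real.pi) * I * (exp (exp ξ) * e) * logK ξ := by
    rw [← hexp]
    linear_combination (c * logI ξ - 2 / Real.pi * logK ξ * s) * I_sq
  have : (Real.pi / 2 : ℂ) * (-(2 / Real.pi) * I) = -I := by field_simp
  linear_combination (Real.pi / 2 * Real.sqrt (2 / Real.pi) * exp (ξ / 2) * e) * key +
    (Real.sqrt (2 / Real.pi) * exp (ξ / 2) * e ^ 2 * exp (exp ξ) * logK ξ) * this +
    (Real.sqrt (2 / Real.pi) * exp (ξ / 2) * exp (exp ξ) * logK ξ) * (-I * h2 - I_sq)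

/-- The second Hankel function `J₀(i x) - i Y₀(i x)` is, up to the same normalisation, `K₀` on the
sheet of the covering reached by turning `x` by `π`. -/
theorem one_add_T1_sub_I_mul_T2 (ξ : ℂ) : 1 + T1 ξ - I * T2 ξ = normK (ξ + I * Real.pi) := by
  have hpi : (Real.pi : ℂ) ≠ 0 := by exact_mod_cast Real.pi_ne_zero
  have hexp : (cos (I * exp ξ - Real.pi / 4) + I * sin (I * exp ξ - Real.pi / 4)) *
      exp (I * (Real.pi / 4)) = exp (-exp ξ) := by
    rw [mul_comm I (sin _), ← exp_mul_I, ← exp_add]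
    congr 1
    linear_combination (exp ξ) * I_sq
  have hhalf : exp ((ξ + I * Real.pi) / 2) = I * exp (ξ / 2) := by
    rw [← exp_add_I_mul_pi_div_two]; ring_nf
  unfold T1 T2
  rw [besselI0_exp, besselY0_log, sqrt_pi_div_two, normK, logK_add_I_mul_pi, exp_add_I_mul_pi,
    hhalf, ← hexp]
  set c := cos (I * exp ξ - Real.pi / 4)
  set s := sin (I * exp ξ - Real.pi / 4)
  set e := exp (I * ((Real.pi : ℂ) / 4)) with he
  have key : (c * logI ξ + s * (I * logI ξ - 2 / Real.pi * logK ξ)) -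
      I * (-s * logI ξ + c * (I * logI ξ - 2 / Real.pi * logK ξ)) =
      2 / Real.pi * I * (c + I * s) * (logK ξ - I * Real.pi * logI ξ) := by
    field_simp
    linear_combination (c * logI ξ * Real.pi * (-1 + 2) + 2 * logI ξ * I * s * Real.pi - 2 * logK ξ * s) * I_sq
  have : (Real.pi / 2 : ℂ) * (2 / Real.pi) = 1 := by field_simp
  linear_combination (Real.pi / 2 * Real.sqrt (2 / Real.pi) * exp (ξ / 2) * e) * key +
    (Real.sqrt (2 / Real.pi) * exp (ξ / 2) * e * I * (c + I * s) *
      (logK ξ - I * Real.pi * logI ξ)) * this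

theorem T1_eq (ξ : ℂ) : T1 ξ = (normK ξ + normK (ξ + I * Real.pi)) / 2 - 1 := by
  linear_combination (one_add_T1_add_I_mul_T2 ξ + one_add_T1_sub_I_mul_T2 ξ) / 2

theorem T2_eq (ξ : ℂ) : T2 ξ = -I * (normK ξ - normK (ξ + I * Real.pi)) / 2 := by
  linear_combination (-I) * (one_add_T1_add_I_mul_T2 ξ - one_add_T1_sub_I_mul_T2 ξ) / 2 +
    T2 ξ * I_sq

theorem differentiable_T1 : Differentiable ℂ T1 := by
  rw [funext T1_eq]
  have := differentiable_normK
  fun_prop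

theorem differentiable_T2 : Differentiable ℂ T2 := by
  rw [funext T2_eq]
  have := differentiable_normK
  fun_prop

end Smyth

/-! ### The factorisation of `φ` -/

namespace Smyth

open Complex Filter Topology

theorem exp_I_mul_pi_div_two_zpow (m : ℤ) : exp (I * m * Real.pi / 2) = I ^ m := by
  have h : (I : ℂ) ^ m = exp (m * (Real.pi / 2 * I)) := by rw [exp_int_mul, exp_pi_div_two_mul_I]
  rw [h]
  congr 1
  ring

theorem exp_xi_div_two (m : ℤ) {z : ℂ} (hz : z ≠ 0) (l : ℂ) :
    exp (xi m z l / 2) = z * (Real.sqrt 2 : ℂ)⁻¹ * (exp (l / 2))⁻¹ * (I ^ m)⁻¹ := by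
  have h2 : exp ((Real.log 2 : ℂ) / 2) = (Real.sqrt 2 : ℂ) := by
    rw [show ((Real.log 2 : ℂ) / 2) = ((Real.log 2 / 2 : ℝ) : ℂ) by push_cast; ring, ← ofReal_exp,
      ← Real.log_sqrt (by norm_num), Real.exp_log (by positivity)]
  rw [show xi m z l / 2 = log z - (Real.log 2 : ℂ) / 2 - l / 2 - I * m * Real.pi / 2 by
    unfold xi; ring, exp_sub, exp_sub, exp_sub, exp_log hz, h2, exp_I_mul_pi_div_two_zpow]
  simp only [div_eq_mul_inv]

theorem exp_div_two_sq (l : ℂ) : exp (l / 2) ^ 2 = exp l := by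
  rw [← exp_nat_mul]; congr 1; push_cast; ring

theorem I_zpow_sq (m : ℤ) : (I ^ m) ^ 2 = (-1 : ℂ) ^ m := by
  rw [← zpow_natCast, ← zpow_mul, mul_comm, zpow_mul, zpow_natCast, I_sq]

theorem neg_one_zpow_sq (m : ℤ) : ((-1 : ℂ) ^ m) ^ 2 = 1 := by
  rw [← zpow_natCast, ← zpow_mul, mul_comm, zpow_mul]
  norm_num

theorem sqrt_two_sq : (Real.sqrt 2 : ℂ) ^ 2 = 2 := by
  exact_mod_cast Real.sq_sqrt (by norm_num : (0 : ℝ) ≤ 2)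

theorem sqrt_two_ne_zero : (Real.sqrt 2 : ℂ) ≠ 0 := by
  exact_mod_cast (Real.sqrt_pos.mpr (by norm_num : (0 : ℝ) < 2)).ne'

theorem exp_xi (m : ℤ) {z : ℂ} (hz : z ≠ 0) (l : ℂ) :
    exp (xi m z l) = (-1) ^ m * ((exp l)⁻¹ * (z ^ 2 / 2)) := by
  have h := exp_div_two_sq (xi m z l)
  have hm : ((-1 : ℂ) ^ m)⁻¹ = (-1) ^ m := by
    rw [inv_eq_of_mul_eq_one_left]; rw [← pow_two, neg_one_zpow_sq]
  rw [← h, exp_xi_div_two m hz, mul_pow, mul_pow, mul_pow, inv_pow, inv_pow, inv_pow, I_zpow_sq,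
    hm, exp_div_two_sq, sqrt_two_sq]
  ring

theorem exp_two_mul_xi (m : ℤ) {z : ℂ} (hz : z ≠ 0) (l : ℂ) :
    exp (2 * xi m z l) = ((exp l)⁻¹) ^ 2 * z ^ 4 / 4 := by
  have : exp (2 * xi m z l) = exp (xi m z l) ^ 2 := by rw [← exp_nat_mul]; norm_num
  rw [this, exp_xi m hz, mul_pow, neg_one_zpow_sq]
  ring

theorem exp_two_mul_natCast_mul_xi (m : ℤ) {z : ℂ} (hz : z ≠ 0) (l : ℂ) (j : ℕ) :
    coeffI j * exp (2 * j * xi m z l) =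
      (exp l)⁻¹ ^ (2 * j) * z ^ (4 * j) / (16 ^ j * ((j.factorial : ℂ)) ^ 2) := by
  have : exp (2 * j * xi m z l) = exp (2 * xi m z l) ^ j := by rw [← exp_nat_mul]; ring_nf
  rw [this, exp_two_mul_xi m hz, coeffI, div_pow, mul_pow, ← pow_mul, ← pow_mul,
    show (16 : ℂ) = 4 * 4 by norm_num, mul_pow (4 : ℂ)]
  field_simp

theorem y0_eq_logI (m : ℤ) {z : ℂ} (hz : z ≠ 0) (l : ℂ) :
    y0 z (exp l) = logI (xi m z l) :=
  tsum_congr fun j => (exp_two_mul_natCast_mul_xi m hz l j).symm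

theorem y1_eq_expSeries (m : ℤ) {z : ℂ} (hz : z ≠ 0) (l : ℂ) :
    y1 z (exp l) = -2 * (exp l)⁻¹ * expSeries coeffS (xi m z l) := by
  unfold y1 expSeries
  congr 1
  refine tsum_congr fun j => ?_
  rw [← exp_two_mul_natCast_mul_xi m hz l j, coeffS, ← mul_assoc]

theorem hasDerivAt_xi (m : ℤ) {z : ℂ} (hz : z ∈ slitPlane) (l : ℂ) :
    HasDerivAt (fun w => xi m w l) (2 / z) z := by
  unfold xi
  simpa [div_eq_mul_inv] using
    (((((hasDerivAt_log hz).const_mul 2).sub_const (Real.log 2 : ℂ)).sub_const l).sub_const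
      (I * m * Real.pi))

theorem sqrt_two_div_pi : (Real.sqrt (2 / Real.pi) : ℂ) = Real.sqrt 2 * (Real.sqrt Real.pi : ℂ)⁻¹ := by
  rw [Real.sqrt_div (by norm_num)]
  push_cast
  rw [div_eq_mul_inv]

/-- The common scalar factor of the first column of `φ₀ K C`. -/
noncomputable def colFactor (m : ℤ) (l : ℂ) : ℂ :=
  (Real.sqrt Real.pi : ℂ)⁻¹ * (exp (l / 2))⁻¹ * (I ^ m)⁻¹

theorem exp_neg_mul_normK_xi (m : ℤ) {z : ℂ} (hz : z ≠ 0) (l : ℂ) :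
    exp (-exp (xi m z l)) * normK (xi m z l) = z * colFactor m l * logK (xi m z l) := by
  rw [normK, exp_xi_div_two m hz, sqrt_two_div_pi, exp_neg, colFactor]
  have := exp_ne_zero (exp (xi m z l))
  have := sqrt_two_ne_zero
  field_simp

theorem exp_mul_normK_xi_add (m : ℤ) {z : ℂ} (hz : z ≠ 0) (l : ℂ) :
    exp (exp (xi m z l)) * normK (xi m z l + I * Real.pi) =
      z * colFactor m l * (I * logK (xi m z l) + Real.pi * logI (xi m z l)) := by
  have hhalf : exp ((xi m z l + I * Real.pi) / 2) = I * exp (xi m z l / 2) := by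
    rw [← exp_add_I_mul_pi_div_two]; ring_nf
  rw [normK, hhalf, logK_add_I_mul_pi, exp_add_I_mul_pi, exp_xi_div_two m hz, sqrt_two_div_pi,
    exp_neg, colFactor]
  have := exp_ne_zero (exp (xi m z l))
  have := sqrt_two_ne_zero
  field_simp
  linear_combination (-logI (xi m z l) * Real.pi) * I_sq

theorem neg_one_zpow_eq_or (m : ℤ) : (-1 : ℂ) ^ m = 1 ∨ (-1 : ℂ) ^ m = -1 :=
  (m.even_or_odd).imp Even.neg_one_zpow Odd.neg_one_zpow

theorem cosh_neg_one_zpow_mul (m : ℤ) (c : ℂ) : cosh ((-1) ^ m * c) = cosh c := by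
  rcases neg_one_zpow_eq_or m with h | h <;> simp [h]

theorem sinh_neg_one_zpow_mul (m : ℤ) (c : ℂ) : sinh ((-1) ^ m * c) = (-1) ^ m * sinh c := by
  rcases neg_one_zpow_eq_or m with h | h <;> simp [h]

/-- The upper entry of the first column of `φ₀ K C`: in it the exponentials of `φ₀` cancel against
those in the definition of `T1`, `T2`, which leaves Bessel functions. -/
theorem phi0_K_upper (m : ℤ) {z : ℂ} (hz : z ≠ 0) (l : ℂ) :
    z⁻¹ * (cosh ((exp l)⁻¹ * (z ^ 2 / 2)) * (1 + T1 (xi m z l)) +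
      sinh ((exp l)⁻¹ * (z ^ 2 / 2)) * ((-1) ^ (m + 1) * I * T2 (xi m z l))) =
    colFactor m l / 2 * ((1 + I) * logK (xi m z l) + Real.pi * logI (xi m z l)) := by
  have h1 := exp_neg_mul_normK_xi m hz l
  have h2 := exp_mul_normK_xi_add m hz l
  rw [← one_add_T1_add_I_mul_T2] at h1
  rw [← one_add_T1_sub_I_mul_T2] at h2
  have hc := cosh_neg_one_zpow_mul m ((exp l)⁻¹ * (z ^ 2 / 2))
  have hs := sinh_neg_one_zpow_mul m ((exp l)⁻¹ * (z ^ 2 / 2))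
  rw [← exp_xi m hz] at hc hs
  have hm : (-1 : ℂ) ^ (m + 1) = -(-1) ^ m := by rw [zpow_add₀ (by norm_num)]; simp
  rw [hm, ← hc]
  have hs' : sinh ((exp l)⁻¹ * (z ^ 2 / 2)) * (-(-1) ^ m * I * T2 (xi m z l)) =
    -(sinh (exp (xi m z l)) * I * T2 (xi m z l)) := by rw [hs]; ring
  rw [hs', cosh, sinh, inv_mul_eq_iff_eq_mul₀ hz]
  linear_combination (h1 + h2) / 2

/-- The lower entry of the first column of `φ₀ K C`. -/
theorem phi0_K_lower (m : ℤ) {z : ℂ} (hz : z ≠ 0) (l : ℂ) :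
    z⁻¹ * (sinh ((exp l)⁻¹ * (z ^ 2 / 2)) * (1 + T1 (xi m z l)) +
      cosh ((exp l)⁻¹ * (z ^ 2 / 2)) * ((-1) ^ (m + 1) * I * T2 (xi m z l))) =
    (-1) ^ m * colFactor m l / 2 * ((I - 1) * logK (xi m z l) + Real.pi * logI (xi m z l)) := by
  have h1 := exp_neg_mul_normK_xi m hz l
  have h2 := exp_mul_normK_xi_add m hz l
  rw [← one_add_T1_add_I_mul_T2] at h1
  rw [← one_add_T1_sub_I_mul_T2] at h2
  have hc := cosh_neg_one_zpow_mul m ((exp l)⁻¹ * (z ^ 2 / 2))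
  have hs := sinh_neg_one_zpow_mul m ((exp l)⁻¹ * (z ^ 2 / 2))
  rw [← exp_xi m hz] at hc hs
  have hm : (-1 : ℂ) ^ (m + 1) = -(-1) ^ m := by rw [zpow_add₀ (by norm_num)]; simp
  have hsq := neg_one_zpow_sq m
  have hs' : sinh ((exp l)⁻¹ * (z ^ 2 / 2)) = (-1) ^ m * sinh (exp (xi m z l)) := by
    rw [hs]; linear_combination (-sinh ((exp l)⁻¹ * (z ^ 2 / 2))) * hsq
  rw [hm, ← hc, hs', cosh, sinh, inv_mul_eq_iff_eq_mul₀ hz]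
  linear_combination (-1) ^ m * (h2 - h1) / 2

theorem phi0_eq (z l : ℂ) : phi0 z l =
    !![cosh ((exp l)⁻¹ * (z ^ 2 / 2)), sinh ((exp l)⁻¹ * (z ^ 2 / 2));
       sinh ((exp l)⁻¹ * (z ^ 2 / 2)), cosh ((exp l)⁻¹ * (z ^ 2 / 2))] := by
  unfold phi0
  generalize (exp l)⁻¹ * (z ^ 2 / 2) = c
  -- The matrix `[[0, 1], [1, 0]]` is diagonalised by `[[1, 1], [1, -1]]`.
  let U : (Matrix (Fin 2) (Fin 2) ℂ)ˣ :=
    ⟨!![1, 1; 1, -1], !![1 / 2, 1 / 2; 1 / 2, -1 / 2],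
      by ext i j; fin_cases i <;> fin_cases j <;> norm_num [Matrix.mul_apply, Fin.sum_univ_two],
      by ext i j; fin_cases i <;> fin_cases j <;> norm_num [Matrix.mul_apply, Fin.sum_univ_two]⟩
  have hdiag : ∀ x y : ℂ, Matrix.diagonal ![x, y] = !![x, 0; 0, y] := fun x y => by
    ext i j; fin_cases i <;> fin_cases j <;> simp
  have h : c • (!![0, 1; 1, 0] : Matrix (Fin 2) (Fin 2) ℂ) =
      (U : Matrix (Fin 2) (Fin 2) ℂ) * Matrix.diagonal ![c, -c] * (U⁻¹).val := by
    rw [hdiag]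
    ext i j
    fin_cases i <;> fin_cases j <;> simp [U, Matrix.mul_apply, Fin.sum_univ_two] <;> ring
  have hd : NormedSpace.exp ![c, -c] = ![exp c, exp (-c)] := by
    ext i
    rw [Pi.coe_exp]
    fin_cases i <;> simp [Complex.exp_eq_exp_ℂ]
  rw [h, Matrix.exp_units_conj, Matrix.exp_diagonal, hd, hdiag]
  ext i j
  fin_cases i <;> fin_cases j <;>
    simp [U, Matrix.mul_apply, Fin.sum_univ_two, cosh, sinh] <;> ring

/-- `A` with the radicals reduced to `√a` and `√π`: the Euler constant survives only linearly. -/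
theorem A_eq {a : ℝ} (ha : 0 < a) (m : ℤ) (l : ℂ) :
    A a m l = (I / (2 * (Real.sqrt Real.pi : ℂ))) •
      !![I ^ m * exp (l / 2) * ((2 * Real.sqrt a - Real.eulerMascheroniConstant / Real.sqrt a) *
          (1 - I) + (m * (1 + I) - 1) * Real.pi / Real.sqrt a),
        (I ^ m)⁻¹ * exp (l / 2) * ((2 * Real.sqrt a - Real.eulerMascheroniConstant / Real.sqrt a) *
          (1 + I) - (m * (1 - I) - 1) * Real.pi / Real.sqrt a);
        I ^ m * (exp (l / 2))⁻¹ * (Real.eulerMascheroniConstant * (1 - I) -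
          (m * (1 + I) - 1) * Real.pi) / Real.sqrt a,
        (I ^ m)⁻¹ * (exp (l / 2))⁻¹ * (Real.eulerMascheroniConstant * (1 + I) +
          (m * (1 - I) - 1) * Real.pi) / Real.sqrt a] := by
  have hg : 0 < Real.eulerMascheroniConstant :=
    lt_trans (by norm_num) Real.one_half_lt_eulerMascheroniConstant
  have e1 : exp (I * (Real.pi / 4)) = (1 + I) / Real.sqrt 2 := by
    have : I * (Real.pi / 4) = ((Real.pi / 4 : ℝ) : ℂ) * I := by push_cast; ring
    rw [this, exp_mul_I, ← ofReal_cos, ← ofReal_sin, Real.cos_pi_div_four, Real.sin_pi_div_four]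
    have := sqrt_two_sq
    have h0 := sqrt_two_ne_zero
    push_cast
    field_simp
    linear_combination (1 + I) * this
  have e2 : exp (-(I * (Real.pi / 4))) = (1 - I) / Real.sqrt 2 := by
    have h0 := sqrt_two_ne_zero
    rw [exp_neg, e1, inv_div, div_eq_div_iff _ h0]
    · linear_combination sqrt_two_sq + I_sq
    · intro h
      have := congrArg re h
      simp at this
  unfold A
  simp only [e1, e2]
  rw [Real.sqrt_div ha.le, Real.sqrt_div hg.le, Real.sqrt_div (by positivity),
    Real.sqrt_mul (by positivity) Real.pi, Real.sqrt_mul (by norm_num)]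
  have hgs : (Real.eulerMascheroniConstant : ℂ) = (Real.sqrt Real.eulerMascheroniConstant : ℂ) ^ 2 := by
    exact_mod_cast (Real.sq_sqrt hg.le).symm
  have ht := sqrt_two_sq
  have ht0 := sqrt_two_ne_zero
  have hg0 : (Real.sqrt Real.eulerMascheroniConstant : ℂ) ≠ 0 := by
    exact_mod_cast (Real.sqrt_pos.mpr hg).ne'
  have hp0 : (Real.sqrt Real.pi : ℂ) ≠ 0 := by exact_mod_cast (Real.sqrt_pos.mpr Real.pi_pos).ne'
  have ha0 : (Real.sqrt a : ℂ) ≠ 0 := by exact_mod_cast (Real.sqrt_pos.mpr ha).ne'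
  have hI0 : I ^ m ≠ 0 := zpow_ne_zero _ I_ne_zero
  have hr0 := exp_ne_zero (l / 2)
  rw [zpow_neg, hgs]
  push_cast
  generalize (Real.sqrt Real.eulerMascheroniConstant : ℂ) = g at *
  generalize (Real.sqrt 2 : ℂ) = t at *
  generalize I ^ m = J at *
  have ht3 : t ^ 3 = 2 * t := by linear_combination t * ht
  ext i j
  fin_cases i <;> fin_cases j <;> simp <;> field_simp <;> rw [ht] <;> ring

/-- The lower left entry of `L`. -/
noncomputable def lowerL (z lam : ℂ) : ℂ := lam⁻¹ * log (z / 2) * y0 z lam + 1 / 4 * y1 z lam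

theorem log_div_two {z : ℂ} (hz : z ≠ 0) : log (z / 2) = log z - (Real.log 2 : ℂ) := by
  have := log_mul_ofReal (1 / 2) (by norm_num) z hz
  rw [Real.log_div (by norm_num) (by norm_num), Real.log_one] at this
  push_cast at this
  rw [show z / 2 = z * (1 / 2) by ring, this, ofReal_log (by norm_num)]
  push_cast
  ring

/-- The terms `log (z / 2)` cancel, so that only `I₀` and `K₀` remain. -/
theorem lowerL_eq (m : ℤ) {z : ℂ} (hz : z ≠ 0) (l : ℂ) :
    lowerL z (exp l) = (exp l)⁻¹ / 2 *
      ((l + I * m * Real.pi - Real.eulerMascheroniConstant) * logI (xi m z l) -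
        logK (xi m z l)) := by
  rw [lowerL, y0_eq_logI m hz, y1_eq_expSeries m hz, log_div_two hz, logK, xi]
  ring

theorem hasDerivAt_y0 {z : ℂ} (hz : z ∈ slitPlane) (l : ℂ) :
    HasDerivAt (fun w => y0 w (exp l)) (deriv (fun w => y0 w (exp l)) z) z := by
  have h : DifferentiableAt ℂ (fun w => logI (xi 0 w l)) z :=
    (differentiable_logI _).comp z (hasDerivAt_xi 0 hz l).differentiableAt
  refine (h.congr_of_eventuallyEq ?_).hasDerivAt
  filter_upwards [isOpen_slitPlane.mem_nhds hz] with w hw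
  exact y0_eq_logI 0 (slitPlane_ne_zero hw) l

theorem hasDerivAt_y1 {z : ℂ} (hz : z ∈ slitPlane) (l : ℂ) :
    HasDerivAt (fun w => y1 w (exp l)) (deriv (fun w => y1 w (exp l)) z) z := by
  have h : DifferentiableAt ℂ (fun w => -2 * (exp l)⁻¹ * expSeries coeffS (xi 0 w l)) z :=
    ((entireCoeff_coeffS.hasDerivAt _).differentiableAt.comp z
      (hasDerivAt_xi 0 hz l).differentiableAt).const_mul _
  refine (h.congr_of_eventuallyEq ?_).hasDerivAt
  filter_upwards [isOpen_slitPlane.mem_nhds hz] with w hw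
  exact y1_eq_expSeries 0 (slitPlane_ne_zero hw) l

theorem hasDerivAt_lowerL {z : ℂ} (hz : z ∈ slitPlane) (l : ℂ) :
    HasDerivAt (fun w => lowerL w (exp l))
      ((exp l)⁻¹ * z⁻¹ * y0 z (exp l) + (exp l)⁻¹ * log (z / 2) * deriv (fun w => y0 w (exp l)) z +
        1 / 4 * deriv (fun w => y1 w (exp l)) z) z := by
  have hlog : HasDerivAt (fun w => (exp l)⁻¹ * log (w / 2)) ((exp l)⁻¹ * z⁻¹) z := by
    have h2 : z / 2 ∈ slitPlane := by
      rw [mem_slitPlane_iff] at hz ⊢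
      simpa using hz
    have := ((hasDerivAt_log h2).comp z ((hasDerivAt_id z).div_const 2)).const_mul (exp l)⁻¹
    refine this.congr_deriv ?_
    have := slitPlane_ne_zero hz
    field_simp
  exact (hlog.mul (hasDerivAt_y0 hz l)).add ((hasDerivAt_y1 hz l).const_mul (1 / 4))

/-- The upper entry of the first column of `φ₀ K C`, as a function of `z`. -/
noncomputable def upperCol (m : ℤ) (l z : ℂ) : ℂ :=
  z⁻¹ * (cosh ((exp l)⁻¹ * (z ^ 2 / 2)) * (1 + T1 (xi m z l)) +
      sinh ((exp l)⁻¹ * (z ^ 2 / 2)) * ((-1) ^ (m + 1) * I * T2 (xi m z l)))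

/-- The lower entry of the first column of `φ₀ K C`, as a function of `z`. -/
noncomputable def lowerCol (m : ℤ) (l z : ℂ) : ℂ :=
  z⁻¹ * (sinh ((exp l)⁻¹ * (z ^ 2 / 2)) * (1 + T1 (xi m z l)) +
      cosh ((exp l)⁻¹ * (z ^ 2 / 2)) * ((-1) ^ (m + 1) * I * T2 (xi m z l)))

theorem differentiableAt_T1_xi (m : ℤ) {z : ℂ} (hz : z ∈ slitPlane) (l : ℂ) :
    DifferentiableAt ℂ (fun w => w⁻¹ + w⁻¹ * T1 (xi m w l)) z := by
  have h : DifferentiableAt ℂ (fun w => T1 (xi m w l)) z :=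
    (differentiable_T1 _).comp z (hasDerivAt_xi m hz l).differentiableAt
  have hi := differentiableAt_inv (𝕜 := ℂ) (slitPlane_ne_zero hz)
  exact hi.add (hi.mul h)

theorem differentiableAt_T2_xi (m : ℤ) {z : ℂ} (hz : z ∈ slitPlane) (l : ℂ) :
    DifferentiableAt ℂ (fun w => w⁻¹ * T2 (xi m w l)) z := by
  have h : DifferentiableAt ℂ (fun w => T2 (xi m w l)) z :=
    (differentiable_T2 _).comp z (hasDerivAt_xi m hz l).differentiableAt
  exact (differentiableAt_inv (𝕜 := ℂ) (slitPlane_ne_zero hz)).mul h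

theorem hasDerivAt_mul_sq (l z : ℂ) :
    HasDerivAt (fun w : ℂ => (exp l)⁻¹ * (w ^ 2 / 2)) ((exp l)⁻¹ * z) z := by
  refine (((hasDerivAt_pow 2 z).div_const 2).const_mul (exp l)⁻¹).congr_deriv ?_
  norm_num

/-- The upper entry of the second column of `φ₀ K C` is `λ z` times this derivative. The summands of
`K` without derivatives come from differentiating `φ₀`. -/
theorem hasDerivAt_upperCol (m : ℤ) {z : ℂ} (hz : z ∈ slitPlane) (l : ℂ) :
    HasDerivAt (upperCol m l) ((exp l)⁻¹ *
      (cosh ((exp l)⁻¹ * (z ^ 2 / 2)) * K m z l 0 1 +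
        sinh ((exp l)⁻¹ * (z ^ 2 / 2)) * K m z l 1 1)) z := by
  have h1 := (differentiableAt_T1_xi m hz l).hasDerivAt
  have h2 := (differentiableAt_T2_xi m hz l).hasDerivAt.const_mul ((-1) ^ (m + 1) * I)
  have hc := hasDerivAt_mul_sq l z
  have hz0 := slitPlane_ne_zero hz
  have h := (hc.ccosh.mul h1).add (hc.csinh.mul h2)
  refine (h.congr_deriv ?_).congr_of_eventuallyEq (.of_forall fun w => ?_)
  · have := exp_ne_zero l
    simp [K]
    field_simp
    ring
  · simp [upperCol]
    ring

theorem hasDerivAt_lowerCol (m : ℤ) {z : ℂ} (hz : z ∈ slitPlane) (l : ℂ) :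
    HasDerivAt (lowerCol m l) ((exp l)⁻¹ *
      (sinh ((exp l)⁻¹ * (z ^ 2 / 2)) * K m z l 0 1 +
        cosh ((exp l)⁻¹ * (z ^ 2 / 2)) * K m z l 1 1)) z := by
  have h1 := (differentiableAt_T1_xi m hz l).hasDerivAt
  have h2 := (differentiableAt_T2_xi m hz l).hasDerivAt.const_mul ((-1) ^ (m + 1) * I)
  have hc := hasDerivAt_mul_sq l z
  have hz0 := slitPlane_ne_zero hz
  have h := (hc.csinh.mul h1).add (hc.ccosh.mul h2)
  refine (h.congr_deriv ?_).congr_of_eventuallyEq (.of_forall fun w => ?_)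
  · have := exp_ne_zero l
    simp [K]
    field_simp
    ring
  · simp [lowerCol]
    ring

/-- The first column of the factorisation is a linear relation between `I₀` and `K₀` with constant
coefficients, hence an identity between the entries of `H A`. This is the upper entry. -/
theorem phi_fst_col_upper {a : ℝ} (ha : 0 < a) (m : ℤ) {z : ℂ} (hz : z ∈ slitPlane) (l : ℂ) :
    I * Real.sqrt a * y0 z (exp l) - exp l / (I * Real.sqrt a) * lowerL z (exp l) =
      (H a l * A a m l) 0 0 * upperCol m l z + (H a l * A a m l) 0 1 * lowerCol m l z := by
  have hz0 := slitPlane_ne_zero hz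
  rw [upperCol, lowerCol, phi0_K_upper m hz0, phi0_K_lower m hz0, lowerL_eq m hz0,
    y0_eq_logI m hz0, A_eq ha, H, colFactor, ← I_zpow_sq, ← exp_div_two_sq l]
  have ha0 : (Real.sqrt a : ℂ) ≠ 0 := by exact_mod_cast (Real.sqrt_pos.mpr ha).ne'
  have has : (a : ℂ) = (Real.sqrt a : ℂ) ^ 2 := by exact_mod_cast (Real.sq_sqrt ha.le).symm
  have hI0 : I ^ m ≠ 0 := zpow_ne_zero _ I_ne_zero
  have hr0 := exp_ne_zero (l / 2)
  have hp0 : (Real.sqrt Real.pi : ℂ) ≠ 0 := by exact_mod_cast (Real.sqrt_pos.mpr Real.pi_pos).ne'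
  have hps : (Real.pi : ℂ) = (Real.sqrt Real.pi : ℂ) ^ 2 := by
    exact_mod_cast (Real.sq_sqrt Real.pi_pos.le).symm
  rw [has, hps]
  generalize (Real.sqrt a : ℂ) = s at *
  generalize (Real.sqrt Real.pi : ℂ) = p at *
  generalize exp (l / 2) = r at *
  generalize I ^ m = J at *
  generalize logI (xi m z l) = b
  generalize logK (xi m z l) = k
  generalize (Real.eulerMascheroniConstant : ℂ) = g
  simp [Matrix.mul_apply, Fin.sum_univ_two]
  field_simp
  ring_nf
  simp only [I_sq, I_pow_three, I_pow_four]
  ring_nf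

theorem phi_fst_col_lower {a : ℝ} (ha : 0 < a) (m : ℤ) {z : ℂ} (hz : z ∈ slitPlane) (l : ℂ) :
    1 / (I * Real.sqrt a) * lowerL z (exp l) =
      (H a l * A a m l) 1 0 * upperCol m l z + (H a l * A a m l) 1 1 * lowerCol m l z := by
  have hz0 := slitPlane_ne_zero hz
  rw [upperCol, lowerCol, phi0_K_upper m hz0, phi0_K_lower m hz0, lowerL_eq m hz0,
    A_eq ha, H, colFactor, ← I_zpow_sq, ← exp_div_two_sq l]
  have ha0 : (Real.sqrt a : ℂ) ≠ 0 := by exact_mod_cast (Real.sqrt_pos.mpr ha).ne'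
  have has : (a : ℂ) = (Real.sqrt a : ℂ) ^ 2 := by exact_mod_cast (Real.sq_sqrt ha.le).symm
  have hI0 : I ^ m ≠ 0 := zpow_ne_zero _ I_ne_zero
  have hr0 := exp_ne_zero (l / 2)
  have hp0 : (Real.sqrt Real.pi : ℂ) ≠ 0 := by exact_mod_cast (Real.sqrt_pos.mpr Real.pi_pos).ne'
  have hps : (Real.pi : ℂ) = (Real.sqrt Real.pi : ℂ) ^ 2 := by
    exact_mod_cast (Real.sq_sqrt Real.pi_pos.le).symm
  rw [has, hps]
  generalize (Real.sqrt a : ℂ) = s at *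
  generalize (Real.sqrt Real.pi : ℂ) = p at *
  generalize exp (l / 2) = r at *
  generalize I ^ m = J at *
  generalize logI (xi m z l) = b
  generalize logK (xi m z l) = k
  generalize (Real.eulerMascheroniConstant : ℂ) = g
  simp [Matrix.mul_apply, Fin.sum_univ_two]
  field_simp
  ring_nf
  simp only [I_sq]
  ring_nf

/-- The factorisation of `φ`. Since the second column of either side is `λ z ∂_z` of the first, only
the first columns have to be compared. -/
theorem phi_eq {a : ℝ} (ha : 0 < a) (m : ℤ) {z : ℂ} (hz : z ∈ slitPlane) (l : ℂ) :
    phi a z (exp l) = H a l * A a m l * phi0 z l * K m z l * C z := by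
  have hz0 := slitPlane_ne_zero hz
  have hl0 := exp_ne_zero l
  -- `d1` and `d2` arise by differentiating the two first-column identities near `z`.
  have d1 : I * Real.sqrt a * deriv (fun w => y0 w (exp l)) z -
      exp l / (I * Real.sqrt a) * ((exp l)⁻¹ * z⁻¹ * y0 z (exp l) +
        (exp l)⁻¹ * log (z / 2) * deriv (fun w => y0 w (exp l)) z +
        1 / 4 * deriv (fun w => y1 w (exp l)) z) = _ :=
    (((hasDerivAt_y0 hz l).const_mul _).sub ((hasDerivAt_lowerL hz l).const_mul _)).unique
      ((((hasDerivAt_upperCol m hz l).const_mul ((H a l * A a m l) 0 0)).add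
        ((hasDerivAt_lowerCol m hz l).const_mul ((H a l * A a m l) 0 1))).congr_of_eventuallyEq
        (by filter_upwards [isOpen_slitPlane.mem_nhds hz] with w hw
            exact phi_fst_col_upper ha m hw l))
  have d2 : 1 / (I * Real.sqrt a) * ((exp l)⁻¹ * z⁻¹ * y0 z (exp l) +
        (exp l)⁻¹ * log (z / 2) * deriv (fun w => y0 w (exp l)) z +
        1 / 4 * deriv (fun w => y1 w (exp l)) z) = _ :=
    ((hasDerivAt_lowerL hz l).const_mul _).unique
      ((((hasDerivAt_upperCol m hz l).const_mul ((H a l * A a m l) 1 0)).add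
        ((hasDerivAt_lowerCol m hz l).const_mul ((H a l * A a m l) 1 1))).congr_of_eventuallyEq
        (by filter_upwards [isOpen_slitPlane.mem_nhds hz] with w hw
            exact phi_fst_col_lower ha m hw l))
  have e1 := phi_fst_col_upper ha m hz l
  have e2 := phi_fst_col_lower ha m hz l
  rw [phi0_eq]
  generalize H a l * A a m l = M at *
  unfold upperCol lowerCol at e1 e2
  unfold lowerL at e1 e2
  have k00 : K m z l 0 0 = 1 + T1 (xi m z l) := by simp [K]
  have k10 : K m z l 1 0 = (-1) ^ (m + 1) * I * T2 (xi m z l) := by simp [K]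
  rw [← k00, ← k10] at e1 e2
  rw [one_div, mul_inv, inv_I] at d2 e2
  ext i j
  fin_cases i <;> fin_cases j
  · simp [phi, L, Matrix.mul_apply, Fin.sum_univ_two, C]
    linear_combination e1
  · simp [phi, L, Matrix.mul_apply, Fin.sum_univ_two, C]
    field_simp at d1 ⊢
    linear_combination d1
  · simp [phi, L, Matrix.mul_apply, Fin.sum_univ_two, C]
    linear_combination e2
  · simp [phi, L, Matrix.mul_apply, Fin.sum_univ_two, C]
    field_simp at d2 ⊢
    linear_combination d2

end Smyth

/-! ### The integral representation of `K₀` on the positive axis -/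

namespace Smyth

open Complex Filter Topology MeasureTheory Set

/-- Weights on `(0, ∞)` whose Laplace transform converges absolutely in `Re x > 0`. -/
def LaplaceWeight (w : ℝ → ℝ) : Prop :=
  ∀ c : ℝ, 0 < c →
    Integrable (fun s => Real.exp (-(c * s)) * w s) (volume.restrict (Ioi 0))

/-- The Laplace transform of `w`, shifted so that its exponential is `e ^ (-x (s + 1))`. -/
noncomputable def laplace (w : ℝ → ℝ) (x : ℂ) : ℂ :=
  ∫ s in Ioi (0 : ℝ), exp (-x * (s + 1)) * (w s : ℂ)

theorem LaplaceWeight.aestronglyMeasurable {w : ℝ → ℝ} (hw : LaplaceWeight w) :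
    AEStronglyMeasurable w (volume.restrict (Ioi 0)) := by
  have h := (hw 1 one_pos).aestronglyMeasurable
  have h2 : AEStronglyMeasurable (fun s : ℝ => Real.exp (1 * s)) (volume.restrict (Ioi 0)) :=
    (by fun_prop : Continuous fun s : ℝ => Real.exp (1 * s)).aestronglyMeasurable
  refine (h2.mul h).congr (.of_forall fun s => ?_)
  simp only [Pi.mul_apply]
  rw [← mul_assoc, ← Real.exp_add]
  simp

theorem LaplaceWeight.mono {w v : ℝ → ℝ} (hw : LaplaceWeight w)
    (hv : AEStronglyMeasurable v (volume.restrict (Ioi 0)))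
    (h : ∀ s, 0 < s → |v s| ≤ |w s|) : LaplaceWeight v := by
  intro c hc
  refine (hw c hc).mono
    ((by fun_prop : Continuous fun s : ℝ => Real.exp (-(c * s))).aestronglyMeasurable.mul hv) ?_
  refine (ae_restrict_iff' measurableSet_Ioi).2 (.of_forall fun s hs => ?_)
  rw [norm_mul, norm_mul]
  gcongr
  exact h s hs

theorem LaplaceWeight.add_one_mul {w : ℝ → ℝ} (hw : LaplaceWeight w) :
    LaplaceWeight fun s => (s + 1) * w s := by
  intro c hc
  refine ((hw (c / 2) (by positivity)).const_mul (2 / c + 1)).mono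
    ((by fun_prop : Continuous fun s : ℝ => Real.exp (-(c * s))).aestronglyMeasurable.mul
      ((by fun_prop : Continuous fun s : ℝ => s + 1).aestronglyMeasurable.mul
        hw.aestronglyMeasurable)) ?_
  refine (ae_restrict_iff' measurableSet_Ioi).2 (.of_forall fun s hs => ?_)
  have hs : 0 < s := hs
  have h1 : c / 2 * s + 1 ≤ Real.exp (c / 2 * s) := Real.add_one_le_exp _
  have h2 : s + 1 ≤ (2 / c + 1) * Real.exp (c / 2 * s) := by
    have : s = 2 / c * (c / 2 * s) := by field_simp
    have h3 : s ≤ 2 / c * Real.exp (c / 2 * s) := by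
      nth_rewrite 1 [this]; gcongr; linarith
    have : 0 < c / 2 * s := by positivity
    nlinarith
  have h4 : Real.exp (-(c * s)) * Real.exp (c / 2 * s) = Real.exp (-(c / 2 * s)) := by
    rw [← Real.exp_add]; ring_nf
  rw [norm_mul, norm_mul, norm_mul, norm_mul, Real.norm_of_nonneg (Real.exp_pos _).le,
    Real.norm_of_nonneg (Real.exp_pos _).le, Real.norm_of_nonneg (by positivity : (0 : ℝ) ≤ s + 1),
    Real.norm_of_nonneg (by positivity : 0 ≤ 2 / c + 1), ← h4]
  calc _ ≤ Real.exp (-(c * s)) * ((2 / c + 1) * Real.exp (c / 2 * s) * ‖w s‖) := by gcongr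
    _ = _ := by ring

theorem LaplaceWeight.integrable {w : ℝ → ℝ} (hw : LaplaceWeight w) {x : ℂ} (hx : 0 < x.re) :
    Integrable (fun s : ℝ => exp (-x * (s + 1)) * (w s : ℂ)) (volume.restrict (Ioi 0)) := by
  refine (hw x.re hx).mono
    ((by fun_prop : Continuous fun s : ℝ => exp (-x * (s + 1))).aestronglyMeasurable.mul
      (Complex.continuous_ofReal.comp_aestronglyMeasurable hw.aestronglyMeasurable)) ?_
  refine (ae_restrict_iff' measurableSet_Ioi).2 (.of_forall fun s hs => ?_)
  rw [norm_mul, norm_mul, norm_exp, norm_real, Real.norm_of_nonneg (Real.exp_pos _).le]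
  gcongr
  simp
  nlinarith

/-- A Laplace transform may be differentiated under the integral sign. -/
theorem LaplaceWeight.hasDerivAt {w : ℝ → ℝ} (hw : LaplaceWeight w) {x : ℂ} (hx : 0 < x.re) :
    HasDerivAt (laplace w) (-laplace (fun s => (s + 1) * w s) x) x := by
  have hU : {y : ℂ | x.re / 2 < y.re} ∈ 𝓝 x :=
    (isOpen_lt continuous_const continuous_re).mem_nhds (by simp; linarith)
  have h := (hasDerivAt_integral_of_dominated_loc_of_deriv_le
    (μ := volume.restrict (Ioi (0 : ℝ)))
    (F := fun (y : ℂ) (s : ℝ) => exp (-y * (s + 1)) * (w s : ℂ))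
    (F' := fun (y : ℂ) (s : ℝ) => -(exp (-y * (s + 1)) * (((s + 1) * w s : ℝ) : ℂ)))
    (bound := fun s => ‖Real.exp (-(x.re / 2 * s)) * ((s + 1) * w s)‖) hU
    (by
      filter_upwards [(isOpen_lt continuous_const continuous_re).mem_nhds hx] with y hy
      exact (hw.integrable hy).aestronglyMeasurable)
    (hw.integrable hx) (hw.add_one_mul.integrable hx).aestronglyMeasurable.neg
    ((ae_restrict_iff' measurableSet_Ioi).2 (.of_forall fun s hs y hy => by
      rw [norm_neg, norm_mul, norm_mul, norm_exp, norm_real,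
        Real.norm_of_nonneg (Real.exp_pos _).le]
      gcongr
      have hs : 0 < s := hs
      have hy : x.re / 2 < y.re := hy
      simp
      nlinarith))
    (hw.add_one_mul (x.re / 2) (by positivity)).norm
    (.of_forall fun s y _ => by
      have h1 : HasDerivAt (fun y : ℂ => -y * ((s : ℂ) + 1)) (-1 * ((s : ℂ) + 1)) y :=
        (hasDerivAt_id y).neg.mul_const _
      refine (h1.cexp.mul_const (w s : ℂ)).congr_deriv ?_
      push_cast
      ring)).2
  rw [integral_neg] at h
  exact h

/-- `√(s (s + 2)) = √(cosh² t - 1)` for `s + 1 = cosh t`. -/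
noncomputable def rho (s : ℝ) : ℝ := Real.sqrt (s * (s + 2))

theorem rho_pos {s : ℝ} (hs : 0 < s) : 0 < rho s := Real.sqrt_pos.mpr (by positivity)

theorem rho_sq {s : ℝ} (hs : 0 < s) : rho s ^ 2 = s * (s + 2) := Real.sq_sqrt (by positivity)

theorem rho_le {s : ℝ} (hs : 0 ≤ s) : rho s ≤ s + 1 :=
  Real.sqrt_le_iff.mpr ⟨by positivity, by nlinarith⟩

theorem continuous_rho : Continuous rho := by unfold rho; fun_prop

theorem hasDerivAt_rho {s : ℝ} (hs : 0 < s) : HasDerivAt rho ((s + 1) / rho s) s := by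
  have h : HasDerivAt (fun s : ℝ => s * (s + 2)) (1 * (s + 2) + s * 1) s :=
    (hasDerivAt_id s).mul ((hasDerivAt_id s).add_const 2)
  refine (h.sqrt (by positivity)).congr_deriv ?_
  have := rho_pos hs
  rw [rho] at *
  field_simp
  ring

theorem laplaceWeight_rpow : LaplaceWeight fun s => s ^ (-(1 / 2) : ℝ) := by
  intro c hc
  have := integrableOn_rpow_mul_exp_neg_mul_rpow (p := 1) (s := -(1 / 2)) (b := c)
    (by norm_num) one_pos hc
  refine Integrable.congr this (.of_forall fun s => ?_)
  simp [mul_comm]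

theorem laplaceWeight_inv_rho : LaplaceWeight fun s => (rho s)⁻¹ := by
  refine laplaceWeight_rpow.mono continuous_rho.measurable.inv.aestronglyMeasurable fun s hs => ?_
  rw [abs_of_pos (inv_pos.mpr (rho_pos hs)), abs_of_pos (Real.rpow_pos_of_pos hs _),
    Real.rpow_neg hs.le, ← Real.sqrt_eq_rpow]
  have := Real.sqrt_pos.mpr hs
  gcongr
  exact Real.sqrt_le_sqrt (by nlinarith)

theorem laplaceWeight_one : LaplaceWeight fun _ => 1 := by
  intro c hc
  have h := integrableOn_exp_mul_Ioi (neg_neg_iff_pos.mpr hc) 0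
  refine Integrable.congr h (.of_forall fun s => ?_)
  simp

theorem laplaceWeight_rho : LaplaceWeight rho :=
  laplaceWeight_one.add_one_mul.mono continuous_rho.aestronglyMeasurable fun s hs => by
    rw [abs_of_pos (rho_pos hs), abs_of_pos (by positivity)]
    simpa using rho_le hs.le

/-- The integral `∫ e ^ (-x (s + 1)) / √(s (s + 2)) ds = ∫ e ^ (-x cosh t) dt` over `(0, ∞)`. -/
noncomputable def intK (x : ℂ) : ℂ := laplace (fun s => (rho s)⁻¹) x

theorem tendsto_exp_neg_mul_add_one_mul {x : ℝ} (hx : 0 < x) :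
    Tendsto (fun s : ℝ => Real.exp (-x * (s + 1)) * (2 * (s + 1))) atTop (𝓝 0) := by
  have h := (Real.tendsto_pow_mul_exp_neg_atTop_nhds_zero 1).comp
    (((tendsto_atTop_add_const_right atTop (1 : ℝ) tendsto_id)).const_mul_atTop hx)
  have := h.const_mul (2 / x)
  rw [mul_zero] at this
  refine this.congr fun s => ?_
  simp
  field_simp

/-- Integration by parts, with `(√(s (s + 2)))' = (s + 1) / √(s (s + 2))`. -/
theorem laplace_rho {x : ℝ} (hx : 0 < x) :
    x * laplace rho x = laplace (fun s => (s + 1) * (rho s)⁻¹) x := by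
  have hx' : 0 < (x : ℂ).re := by simpa
  have hd : ∀ s ∈ Ioi (0 : ℝ), HasDerivAt (fun s : ℝ => exp (-x * (s + 1)) * (rho s : ℂ))
      (exp (-x * (s + 1)) * (((s + 1) * (rho s)⁻¹ : ℝ) : ℂ) -
        x * (exp (-x * (s + 1)) * (rho s : ℂ))) s := by
    intro s hs
    have h1 : HasDerivAt (fun s : ℝ => -(x : ℂ) * ((s : ℂ) + 1)) (-x * 1) s :=
      (((hasDerivAt_id s).ofReal_comp).add_const 1).const_mul _
    refine (h1.cexp.mul (hasDerivAt_rho hs).ofReal_comp).congr_deriv ?_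
    push_cast
    ring
  have i1 := laplaceWeight_inv_rho.add_one_mul.integrable hx'
  have i2 := (laplaceWeight_rho.integrable hx').const_mul (x : ℂ)
  have hlim : Tendsto (fun s : ℝ => exp (-x * (s + 1)) * (rho s : ℂ)) atTop (𝓝 0) := by
    refine squeeze_zero_norm' ?_ (tendsto_exp_neg_mul_add_one_mul hx)
    filter_upwards [eventually_gt_atTop 0] with s hs
    rw [norm_mul, norm_exp, norm_real, Real.norm_of_nonneg (rho_pos hs).le]
    have : (-(x : ℂ) * (s + 1)).re = -x * (s + 1) := by simp
    rw [this]
    gcongr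
    linarith [rho_le hs.le]
  have hcont : Continuous fun s : ℝ => exp (-x * (s + 1)) * (rho s : ℂ) := by
    have := continuous_rho
    fun_prop
  have h := integral_Ioi_of_hasDerivAt_of_tendsto hcont.continuousWithinAt hd (i1.sub i2) hlim
  rw [integral_sub i1 i2, integral_const_mul] at h
  have h0 : rho 0 = 0 := by simp [rho]
  simp only [h0] at h
  unfold laplace
  simp only [ofReal_zero, mul_zero, sub_zero] at h
  exact (sub_eq_zero.mp h).symm

theorem laplace_add_one_sq {x : ℝ} (hx : 0 < x) :
    laplace (fun s => (s + 1) * ((s + 1) * (rho s)⁻¹)) x = intK x + laplace rho x := by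
  have hx' : 0 < (x : ℂ).re := by simpa
  unfold intK laplace
  rw [← integral_add (laplaceWeight_inv_rho.integrable hx') (laplaceWeight_rho.integrable hx')]
  refine setIntegral_congr_fun measurableSet_Ioi fun s hs => ?_
  simp only
  rw [← mul_add]
  congr 1
  have h1 := rho_pos hs
  have h2 := rho_sq hs
  norm_cast
  field_simp
  nlinarith

/-- The derivative of `t ↦ intK (e ^ t)`. -/
noncomputable def intKDeriv (t : ℝ) : ℂ :=
  -(Real.exp t : ℂ) * laplace (fun s => (s + 1) * (rho s)⁻¹) (Real.exp t : ℝ)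

theorem hasDerivAt_ofReal_exp (t : ℝ) :
    HasDerivAt (fun t : ℝ => ((Real.exp t : ℝ) : ℂ)) (Real.exp t : ℝ) t :=
  (Real.hasDerivAt_exp t).ofReal_comp

theorem hasDerivAt_intK (t : ℝ) :
    HasDerivAt (fun t : ℝ => intK (Real.exp t : ℝ)) (intKDeriv t) t := by
  have hx : 0 < ((Real.exp t : ℝ) : ℂ).re := by rw [ofReal_re]; exact Real.exp_pos t
  refine ((laplaceWeight_inv_rho.hasDerivAt hx).comp t (hasDerivAt_ofReal_exp t)).congr_deriv ?_
  rw [intKDeriv]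
  ring

/-- The modified Bessel equation for the integral. -/
theorem hasDerivAt_intKDeriv (t : ℝ) :
    HasDerivAt intKDeriv ((Real.exp t : ℂ) ^ 2 * intK (Real.exp t : ℝ)) t := by
  have hx : 0 < ((Real.exp t : ℝ) : ℂ).re := by rw [ofReal_re]; exact Real.exp_pos t
  have h := (laplaceWeight_inv_rho.add_one_mul.hasDerivAt hx).comp t (hasDerivAt_ofReal_exp t)
  have h1 := (hasDerivAt_ofReal_exp t).neg.mul h
  refine h1.congr_deriv ?_
  have e1 := laplace_add_one_sq (Real.exp_pos t)
  have e2 := laplace_rho (Real.exp_pos t)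
  simp only [Function.comp]
  rw [e1, ← e2]
  simp only [Pi.neg_apply]
  ring

/-- `intK` on the positive axis, as a real integral. -/
noncomputable def realK (x : ℝ) : ℝ := ∫ s in Ioi (0 : ℝ), Real.exp (-x * (s + 1)) * (rho s)⁻¹

theorem intK_ofReal (x : ℝ) : intK x = realK x := by
  unfold intK laplace realK
  rw [← integral_complex_ofReal]
  refine integral_congr_ae (.of_forall fun s => ?_)
  push_cast
  rfl

/-- The primitive `arcosh (s + 1)` of `1 / √(s (s + 2))`. -/
noncomputable def arcoshOne (s : ℝ) : ℝ := Real.log (s + 1 + rho s)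

theorem arcoshOne_nonneg {s : ℝ} (hs : 0 ≤ s) : 0 ≤ arcoshOne s := by
  refine Real.log_nonneg ?_
  have : 0 ≤ rho s := Real.sqrt_nonneg _
  linarith

theorem arcoshOne_le {s : ℝ} (hs : 0 ≤ s) : arcoshOne s ≤ 2 * (s + 1) := by
  have : 0 ≤ rho s := Real.sqrt_nonneg _
  have h := Real.log_le_sub_one_of_pos (by positivity : 0 < s + 1 + rho s)
  have := rho_le hs
  unfold arcoshOne
  linarith

theorem hasDerivAt_arcoshOne {s : ℝ} (hs : 0 < s) : HasDerivAt arcoshOne (rho s)⁻¹ s := by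
  have h1 := rho_pos hs
  refine ((((hasDerivAt_id s).add_const 1).add (hasDerivAt_rho hs)).log ?_).congr_deriv ?_
  · simp; positivity
  · simp
    have : s + 1 + rho s ≠ 0 := by positivity
    field_simp
    ring

theorem continuousOn_arcoshOne : ContinuousOn arcoshOne (Ici 0) := by
  intro s hs
  have h1 : 0 ≤ s := hs
  have h2 : 0 ≤ rho s := Real.sqrt_nonneg _
  refine ContinuousAt.continuousWithinAt ?_
  unfold arcoshOne
  refine ContinuousAt.log ?_ (by positivity)
  have := continuous_rho
  fun_prop

theorem laplaceWeight_arcoshOne : LaplaceWeight arcoshOne := by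
  refine (LaplaceWeight.add_one_mul (w := fun _ => 2) fun c hc => ?_).mono
    ((continuousOn_arcoshOne.mono Ioi_subset_Ici_self).aestronglyMeasurable measurableSet_Ioi) ?_
  · simpa using (laplaceWeight_one c hc).mul_const 2
  · intro s hs
    rw [abs_of_nonneg (arcoshOne_nonneg hs.le), abs_of_pos (by positivity)]
    linarith [arcoshOne_le hs.le]

theorem LaplaceWeight.integrable_real {w : ℝ → ℝ} (hw : LaplaceWeight w) {x : ℝ} (hx : 0 < x) :
    Integrable (fun s : ℝ => Real.exp (-x * (s + 1)) * w s) (volume.restrict (Ioi 0)) := by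
  refine ((hw x hx).const_mul (Real.exp (-x))).congr (.of_forall fun s => ?_)
  simp only
  rw [← mul_assoc, ← Real.exp_add]
  ring_nf

/-- Integration by parts removes the singularity of the weight. -/
theorem realK_eq {x : ℝ} (hx : 0 < x) :
    realK x = x * ∫ s in Ioi (0 : ℝ), Real.exp (-x * (s + 1)) * arcoshOne s := by
  have i1 := laplaceWeight_inv_rho.integrable_real hx
  have i2 := (laplaceWeight_arcoshOne.integrable_real hx).const_mul x
  have hd : ∀ s ∈ Ioi (0 : ℝ), HasDerivAt (fun s : ℝ => Real.exp (-x * (s + 1)) * arcoshOne s)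
      (Real.exp (-x * (s + 1)) * (rho s)⁻¹ - x * (Real.exp (-x * (s + 1)) * arcoshOne s)) s := by
    intro s hs
    have h1 : HasDerivAt (fun s : ℝ => -x * (s + 1)) (-x * 1) s :=
      ((hasDerivAt_id s).add_const 1).const_mul _
    refine (h1.exp.mul (hasDerivAt_arcoshOne hs)).congr_deriv ?_
    ring
  have hlim : Tendsto (fun s : ℝ => Real.exp (-x * (s + 1)) * arcoshOne s) atTop (𝓝 0) := by
    refine squeeze_zero_norm' ?_ (tendsto_exp_neg_mul_add_one_mul hx)
    filter_upwards [eventually_gt_atTop 0] with s hs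
    rw [norm_mul, Real.norm_of_nonneg (Real.exp_pos _).le,
      Real.norm_of_nonneg (arcoshOne_nonneg hs.le)]
    gcongr
    exact arcoshOne_le hs.le
  have hcont : ContinuousWithinAt (fun s : ℝ => Real.exp (-x * (s + 1)) * arcoshOne s) (Ici 0) 0 :=
    (by fun_prop : Continuous fun s : ℝ => Real.exp (-x * (s + 1))).continuousWithinAt.mul
      (continuousOn_arcoshOne 0 self_mem_Ici)
  have h := integral_Ioi_of_hasDerivAt_of_tendsto hcont hd (i1.sub i2) hlim
  rw [integral_sub i1 i2, integral_const_mul] at h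
  have h0 : arcoshOne 0 = 0 := by simp [arcoshOne, rho]
  rw [h0, mul_zero, sub_zero] at h
  exact sub_eq_zero.mp h

/-- The logarithm that remains after the rescaling `s = u / x`. -/
noncomputable def logSum (x u : ℝ) : ℝ := Real.log (u + x + Real.sqrt (u * (u + 2 * x)))

theorem arcoshOne_div {x u : ℝ} (hx : 0 < x) (hu : 0 < u) :
    arcoshOne (x⁻¹ * u) = logSum x u - Real.log x := by
  have : x⁻¹ * u + 1 + rho (x⁻¹ * u) = (u + x + Real.sqrt (u * (u + 2 * x))) / x := by
    have h : rho (x⁻¹ * u) = Real.sqrt (u * (u + 2 * x)) / x := by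
      rw [rho, ← Real.sqrt_sq hx.le, ← Real.sqrt_div (by positivity), Real.sqrt_sq hx.le]
      congr 1
      field_simp
    rw [h]
    field_simp
  rw [arcoshOne, this, Real.log_div (by positivity) hx.ne', logSum]

theorem abs_log_le {u : ℝ} (hu : 0 < u) : |Real.log u| ≤ u + 2 * u ^ (-(1 / 2) : ℝ) := by
  have hp : 0 < u ^ (-(1 / 2) : ℝ) := Real.rpow_pos_of_pos hu _
  rw [abs_le]
  constructor
  · have h := Real.log_le_rpow_div (inv_pos.mpr hu).le (by norm_num : (0 : ℝ) < 1 / 2)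
    rw [Real.log_inv, Real.inv_rpow hu.le, ← Real.rpow_neg hu.le] at h
    linarith
  · linarith [Real.log_le_sub_one_of_pos hu]

theorem abs_logSum_le {x u : ℝ} (hx : 0 < x) (hx1 : x ≤ 1) (hu : 0 < u) :
    |logSum x u| ≤ (u + 1) * 2 + 2 * u ^ (-(1 / 2) : ℝ) := by
  have hs : 0 ≤ Real.sqrt (u * (u + 2 * x)) := Real.sqrt_nonneg _
  have hs2 : Real.sqrt (u * (u + 2 * x)) ≤ u + x :=
    Real.sqrt_le_iff.mpr ⟨by positivity, by nlinarith⟩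
  have hp : 0 < u ^ (-(1 / 2) : ℝ) := Real.rpow_pos_of_pos hu _
  have h1 := abs_le.mp (abs_log_le hu)
  rw [abs_le]
  constructor
  · have : Real.log u ≤ logSum x u := Real.log_le_log hu (by linarith)
    linarith
  · have : logSum x u ≤ _ := Real.log_le_sub_one_of_pos (by positivity)
    linarith

theorem laplaceWeight_bound :
    LaplaceWeight fun u => (u + 1) * 2 + 2 * u ^ (-(1 / 2) : ℝ) := by
  intro c hc
  have h1 := (laplaceWeight_one.add_one_mul c hc).mul_const 2
  have h2 := (laplaceWeight_rpow c hc).mul_const 2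
  refine (h1.add h2).congr (.of_forall fun s => ?_)
  simp only [Pi.add_apply]
  ring

theorem measurable_logSum (x : ℝ) : Measurable (logSum x) := by
  unfold logSum
  fun_prop

theorem laplaceWeight_logSum {x : ℝ} (hx : 0 < x) (hx1 : x ≤ 1) : LaplaceWeight (logSum x) :=
  laplaceWeight_bound.mono (measurable_logSum x).aestronglyMeasurable fun _ hu =>
    (abs_logSum_le hx hx1 hu).trans (le_abs_self _)

/-- `Γ'(1) = -γ`, written as an integral. -/
theorem integral_exp_neg_mul_log :
    ∫ u in Ioi (0 : ℝ), Real.exp (-u) * Real.log u = -Real.eulerMascheroniConstant := by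
  have h := hasDerivAt_GammaIntegral (s := 1) (by simp)
  have h2 : HasDerivAt GammaIntegral (-Real.eulerMascheroniConstant : ℂ) 1 := by
    refine Complex.hasDerivAt_Gamma_one.congr_of_eventuallyEq ?_
    filter_upwards [(isOpen_lt continuous_const continuous_re).mem_nhds
      (by simp : (0 : ℝ) < (1 : ℂ).re)] with w hw
    exact (Gamma_eq_integral hw).symm
  have h3 := h.unique h2
  have h4 : (∫ u in Ioi (0 : ℝ), ((Real.exp (-u) * Real.log u : ℝ) : ℂ)) =
      -Real.eulerMascheroniConstant := by
    rw [← h3]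
    refine integral_congr_ae (.of_forall fun u => ?_)
    simp [mul_comm]
  rw [integral_complex_ofReal] at h4
  exact_mod_cast h4

theorem realK_eq_logSum {x : ℝ} (hx : 0 < x) (hx1 : x ≤ 1) :
    realK x = Real.exp (-x) * ((∫ u in Ioi (0 : ℝ), Real.exp (-u) * logSum x u) - Real.log x) := by
  have h := integral_comp_mul_left_Ioi' (fun u => Real.exp (-u) * (logSum x u - Real.log x)) 0 hx
  rw [mul_zero] at h
  have e : ∀ s ∈ Ioi (0 : ℝ), Real.exp (-x * (s + 1)) * arcoshOne s =
      Real.exp (-x) * (Real.exp (-(x * s)) * (logSum x (x * s) - Real.log x)) := by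
    intro s hs
    have hs : 0 < s := hs
    rw [← arcoshOne_div hx (by positivity), inv_mul_cancel_left₀ hx.ne', ← mul_assoc, ← Real.exp_add]
    ring_nf
  rw [realK_eq hx, setIntegral_congr_fun measurableSet_Ioi e, integral_const_mul]
  rw [smul_eq_mul] at h
  rw [mul_left_comm, h]
  congr 1
  have i1 : Integrable (fun u => Real.exp (-u) * logSum x u) (volume.restrict (Ioi 0)) := by
    simpa using laplaceWeight_logSum hx hx1 1 one_pos
  have i2 : Integrable (fun u : ℝ => Real.exp (-u) * Real.log x) (volume.restrict (Ioi 0)) := by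
    simpa using (laplaceWeight_one 1 one_pos).mul_const (Real.log x)
  simp only [mul_sub]
  rw [integral_sub i1 i2, integral_mul_const, integral_exp_neg_Ioi_zero, one_mul]

theorem tendsto_integral_logSum :
    Tendsto (fun x => ∫ u in Ioi (0 : ℝ), Real.exp (-u) * logSum x u) (𝓝[>] 0)
      (𝓝 (Real.log 2 - Real.eulerMascheroniConstant)) := by
  have hval : ∫ u in Ioi (0 : ℝ), Real.exp (-u) * (Real.log 2 + Real.log u) =
      Real.log 2 - Real.eulerMascheroniConstant := by
    have i1 : Integrable (fun u : ℝ => Real.exp (-u) * Real.log 2) (volume.restrict (Ioi 0)) := by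
      simpa using (laplaceWeight_one 1 one_pos).mul_const (Real.log 2)
    have i2 : Integrable (fun u : ℝ => Real.exp (-u) * Real.log u) (volume.restrict (Ioi 0)) := by
      have : LaplaceWeight Real.log :=
        laplaceWeight_bound.mono Real.measurable_log.aestronglyMeasurable fun u hu => by
          have hp : 0 < u ^ (-(1 / 2) : ℝ) := Real.rpow_pos_of_pos hu _
          refine (abs_log_le hu).trans (le_trans ?_ (le_abs_self _))
          linarith
      simpa using this 1 one_pos
    simp only [mul_add]
    rw [integral_add i1 i2, integral_mul_const, integral_exp_neg_Ioi_zero, integral_exp_neg_mul_log]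
    ring
  rw [← hval]
  refine tendsto_integral_filter_of_dominated_convergence
    (fun u => Real.exp (-u) * ((u + 1) * 2 + 2 * u ^ (-(1 / 2) : ℝ)))
    (.of_forall fun x => ((by fun_prop : Continuous fun u : ℝ => Real.exp (-u)).measurable.mul
      (measurable_logSum x)).aestronglyMeasurable) ?_ ?_ ?_
  · filter_upwards [Ioo_mem_nhdsGT one_pos] with x hx
    refine (ae_restrict_iff' measurableSet_Ioi).2 (.of_forall fun u hu => ?_)
    rw [norm_mul, Real.norm_of_nonneg (Real.exp_pos _).le]
    gcongr
    exact abs_logSum_le hx.1 hx.2.le hu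
  · simpa using laplaceWeight_bound 1 one_pos
  · refine (ae_restrict_iff' measurableSet_Ioi).2 (.of_forall fun u hu => ?_)
    have hu : 0 < u := hu
    have e : Real.log 2 + Real.log u = logSum 0 u := by
      rw [logSum, ← Real.log_mul (by norm_num) hu.ne']
      congr 1
      simp [Real.sqrt_mul_self hu.le]
      ring
    rw [e]
    have : ContinuousAt (fun x => logSum x u) 0 := by
      unfold logSum
      refine ContinuousAt.log (by fun_prop) ?_
      have : 0 ≤ Real.sqrt (u * (u + 2 * 0)) := Real.sqrt_nonneg _
      positivity
    exact (this.tendsto.mono_left nhdsWithin_le_nhds).const_mul _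

/-- The behaviour of `∫ e ^ (-x cosh t) dt` at the origin, which singles out `K₀` among the
solutions of the modified Bessel equation. -/
theorem tendsto_realK_add_log :
    Tendsto (fun x => realK x + Real.log x) (𝓝[>] 0)
      (𝓝 (Real.log 2 - Real.eulerMascheroniConstant)) := by
  have h0 : Tendsto (fun x : ℝ => Real.exp (-x)) (𝓝[>] 0) (𝓝 1) := by
    have : Continuous fun x : ℝ => Real.exp (-x) := by fun_prop
    simpa using (this.tendsto 0).mono_left nhdsWithin_le_nhds
  have h1 : Tendsto (fun x : ℝ => (1 - Real.exp (-x)) * Real.log x) (𝓝[>] 0) (𝓝 0) := by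
    have h2 : Tendsto (fun x : ℝ => |Real.log x * x ^ (1 : ℝ)|) (𝓝[>] 0) (𝓝 0) := by
      simpa using (tendsto_log_mul_rpow_nhdsGT_zero one_pos).abs
    refine squeeze_zero_norm' ?_ h2
    filter_upwards [self_mem_nhdsWithin] with x hx
    have hx : 0 < x := hx
    have h3 : 1 - Real.exp (-x) ≤ x := by linarith [Real.add_one_le_exp (-x)]
    have h4 : 0 ≤ 1 - Real.exp (-x) := by
      have := Real.exp_le_one_iff.mpr (neg_nonpos.mpr hx.le); linarith
    rw [Real.rpow_one, norm_mul, abs_mul, mul_comm, Real.norm_eq_abs, Real.norm_eq_abs,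
      abs_of_nonneg h4, abs_of_pos hx]
    gcongr
  have h := (h0.mul tendsto_integral_logSum).add h1
  rw [one_mul, add_zero] at h
  refine h.congr' ?_
  filter_upwards [Ioo_mem_nhdsGT one_pos] with x hx
  rw [realK_eq_logSum hx.1 hx.2.le]
  ring

end Smyth

/-! ### Uniqueness of solutions and analytic continuation -/

namespace Smyth

open Complex Filter Topology MeasureTheory Set

/-- Uniqueness for `f'' = q f` on the line: if `b` is a solution tending to `1` at `-∞`, then a
solution tending to `0` at `-∞` vanishes near `-∞`. Indeed `(f / b)' = W / b ^ 2` with a constant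
Wronskian `W`, so `f / b` grows linearly unless `W = 0`. -/
theorem eventually_eq_zero_of_tendsto {f f' b b' q : ℝ → ℂ}
    (hf : ∀ t, HasDerivAt f (f' t) t) (hf' : ∀ t, HasDerivAt f' (q t * f t) t)
    (hb : ∀ t, HasDerivAt b (b' t) t) (hb' : ∀ t, HasDerivAt b' (q t * b t) t)
    (hb1 : Tendsto b atBot (𝓝 1)) (hf0 : Tendsto f atBot (𝓝 0)) :
    ∀ᶠ t in atBot, f t = 0 := by
  obtain ⟨W, hW⟩ : ∃ W, ∀ t, f' t * b t - f t * b' t = W := by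
    have hd : ∀ t, HasDerivAt (fun t => f' t * b t - f t * b' t) 0 t := fun t => by
      refine (((hf' t).mul (hb t)).sub ((hf t).mul (hb' t))).congr_deriv ?_
      ring
    exact ⟨_, fun t => is_const_of_deriv_eq_zero (fun t => (hd t).differentiableAt)
      (fun t => (hd t).deriv) t 0⟩
  have hquot : ∀ t, b t ≠ 0 → HasDerivAt (fun t => f t / b t) (W / b t ^ 2) t := fun t ht => by
    refine ((hf t).div (hb t) ht).congr_deriv ?_
    rw [hW]
  have hh0 : Tendsto (fun t => f t / b t) atBot (𝓝 0) := by
    have := hf0.div hb1 one_ne_zero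
    rw [zero_div] at this
    exact this
  have hbne : ∀ᶠ t in atBot, b t ≠ 0 := hb1.eventually_ne one_ne_zero
  -- The increment of `f / b` over `[t - 1, t]` tends both to `W` and to `0` as `t → -∞`.
  have hW0 : W = 0 := by
    have hlim : Tendsto (fun t => W / b t ^ 2 - W) atBot (𝓝 0) := by
      have := (tendsto_const_nhds (x := W)).div (hb1.pow 2) (by norm_num)
      simpa using this.sub_const W
    refine norm_le_zero_iff.mp (le_of_forall_pos_le_add fun ε hε => ?_)
    obtain ⟨T, hT⟩ := (hbne.and (hlim.norm.eventually_le_const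
      (by simpa using half_pos hε : ‖(0 : ℂ)‖ < ε / 2))).exists_forall_of_atBot
    have hk : ∀ t ≤ T, ‖(f t / b t - W * t) - (f (t - 1) / b (t - 1) - W * (t - 1 : ℝ))‖ ≤
        ε / 2 := by
      intro t ht
      have := (convex_Iic T).norm_image_sub_le_of_norm_hasDerivWithin_le
        (f := fun t : ℝ => f t / b t - W * t) (f' := fun t => W / b t ^ 2 - W) (C := ε / 2)
        (x := t - 1) (y := t) (fun s hs => by
          refine ((hquot s (hT s hs).1).sub
            (((hasDerivAt_id s).ofReal_comp).const_mul W)).hasDerivWithinAt.congr_deriv ?_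
          simp) (fun s hs => (hT s hs).2) (mem_Iic.mpr (by linarith)) ht
      simpa using this
    have hlim2 : Tendsto (fun t => ‖f t / b t - f (t - 1) / b (t - 1)‖) atBot (𝓝 0) := by
      simpa [sub_eq_add_neg] using
        (hh0.sub (hh0.comp (tendsto_atBot_add_const_right atBot (-1 : ℝ) tendsto_id))).norm
    obtain ⟨t, ht1, ht2⟩ := ((hlim2.eventually_le_const (half_pos hε)).and
      (eventually_le_atBot T)).exists
    have h3 := hk t ht2
    have : W = (f t / b t - f (t - 1) / b (t - 1)) -
        ((f t / b t - W * t) - (f (t - 1) / b (t - 1) - W * (t - 1 : ℝ))) := by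
      push_cast; ring
    rw [this, zero_add]
    refine (norm_sub_le _ _).trans ?_
    linarith
  obtain ⟨T, hT⟩ := hbne.exists_forall_of_atBot
  have hconst : ∀ s ≤ T, ∀ t ≤ T, f t / b t = f s / b s := by
    intro s hs t ht
    have := (convex_Iic T).norm_image_sub_le_of_norm_hasDerivWithin_le
      (f := fun t : ℝ => f t / b t) (f' := fun _ => 0) (C := 0) (x := s) (y := t)
      (fun r hr => by simpa [hW0] using (hquot r (hT r hr)).hasDerivWithinAt)
      (fun r _ => by simp) hs ht
    rw [zero_mul] at this
    exact sub_eq_zero.mp (norm_le_zero_iff.mp this)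
  filter_upwards [eventually_le_atBot T] with t ht
  have h : Tendsto (fun _ : ℝ => f t / b t) atBot (𝓝 0) := by
    refine hh0.congr' ?_
    filter_upwards [eventually_le_atBot T] with s hs
    exact (hconst s hs t ht).symm
  have := tendsto_nhds_unique tendsto_const_nhds h
  exact (div_eq_zero_iff.mp this).resolve_right (hT t ht)

/-- Two holomorphic functions on a horizontal strip which agree near `-∞` on a horizontal line of
the strip are equal. -/
theorem eqOn_strip {f g : ℂ → ℂ} {θ r : ℝ} (hr : 0 < r)
    (hf : DifferentiableOn ℂ f {ξ | |ξ.im - θ| < r})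
    (hg : DifferentiableOn ℂ g {ξ | |ξ.im - θ| < r})
    (h : ∀ᶠ t : ℝ in atBot, f (t + θ * I) = g (t + θ * I)) :
    EqOn f g {ξ | |ξ.im - θ| < r} := by
  have hopen : IsOpen {ξ : ℂ | |ξ.im - θ| < r} :=
    isOpen_lt (by fun_prop) continuous_const
  have hconv : Convex ℝ {ξ : ℂ | |ξ.im - θ| < r} := by
    have : {ξ : ℂ | |ξ.im - θ| < r} = imLm ⁻¹' Ioo (θ - r) (θ + r) := by
      ext ξ
      simp only [mem_ofPred_eq, mem_preimage, imLm_coe, mem_Ioo, abs_lt]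
      constructor <;> rintro ⟨h1, h2⟩ <;> constructor <;> linarith
    rw [this]
    exact (convex_Ioo _ _).linear_preimage imLm
  obtain ⟨T, hT⟩ := h.exists_forall_of_atBot
  refine (hf.analyticOnNhd hopen).eqOn_of_preconnected_of_frequently_eq (hg.analyticOnNhd hopen)
    hconv.isPreconnected (z₀ := (T - 1 : ℝ) + θ * I) (by simpa using hr) ?_
  have hcont : Tendsto (fun t : ℝ => (t : ℂ) + θ * I) (𝓝[≠] (T - 1))
      (𝓝[≠] (((T - 1 : ℝ) : ℂ) + θ * I)) := by
    refine tendsto_nhdsWithin_of_tendsto_nhds_of_eventually_within _ ?_ ?_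
    · exact (by fun_prop : Continuous fun t : ℝ => (t : ℂ) + θ * I).continuousAt.mono_left
        nhdsWithin_le_nhds
    · filter_upwards [self_mem_nhdsWithin] with t ht
      have ht : t ≠ T - 1 := ht
      simp only [mem_compl_iff, mem_singleton_iff, add_left_inj]
      exact_mod_cast ht
  refine hcont.frequently (Eventually.frequently ?_)
  have : ∀ᶠ t in 𝓝 (T - 1), t ≤ T := eventually_le_nhds (by linarith)
  filter_upwards [nhdsWithin_le_nhds this] with t ht
  exact hT t ht

theorem EntireCoeff.norm_expSeries_sub_le {c : ℕ → ℂ} (hc : EntireCoeff c) :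
    ∃ C, ∀ t : ℝ, t ≤ 0 → ‖expSeries c t - c 0‖ ≤ C * Real.exp (2 * t) := by
  have hs : Summable fun j => ‖c (j + 1)‖ := by
    have := hc 1 one_pos
    simp only [one_pow, mul_one] at this
    exact (summable_nat_add_iff 1).mpr this
  refine ⟨∑' j, ‖c (j + 1)‖, fun t ht => ?_⟩
  rw [expSeries, (hc.summable t).tsum_eq_zero_add]
  simp only [Nat.cast_zero, mul_zero, zero_mul, exp_zero, mul_one, add_sub_cancel_left]
  refine tsum_of_norm_bounded (hs.hasSum.mul_right _) fun j => ?_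
  rw [norm_mul, norm_exp]
  gcongr
  have : (2 * ((j + 1 : ℕ) : ℂ) * t).re = 2 * (j + 1) * t := by
    norm_cast
  rw [this]
  nlinarith [mul_nonneg (Nat.cast_nonneg (α := ℝ) j) (neg_nonneg.mpr ht)]

theorem tendsto_exp_two_mul_atBot : Tendsto (fun t : ℝ => Real.exp (2 * t)) atBot (𝓝 0) :=
  Real.tendsto_exp_atBot.comp (tendsto_id.const_mul_atBot two_pos)

theorem tendsto_mul_exp_two_mul_atBot :
    Tendsto (fun t : ℝ => t * Real.exp (2 * t)) atBot (𝓝 0) := by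
  have h := (Real.tendsto_pow_mul_exp_neg_atTop_nhds_zero 1).comp
    (tendsto_neg_atBot_atTop.const_mul_atTop (two_pos (α := ℝ)))
  have := h.const_mul (-(1 / 2))
  rw [mul_zero] at this
  refine this.congr fun t => ?_
  simp
  ring

theorem EntireCoeff.tendsto_expSeries {c : ℕ → ℂ} (hc : EntireCoeff c) :
    Tendsto (fun t : ℝ => expSeries c t) atBot (𝓝 (c 0)) := by
  obtain ⟨C, hC⟩ := hc.norm_expSeries_sub_le
  rw [tendsto_iff_norm_sub_tendsto_zero]
  refine squeeze_zero' (.of_forall fun _ => norm_nonneg _) ?_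
    (by simpa using tendsto_exp_two_mul_atBot.const_mul C)
  filter_upwards [eventually_le_atBot 0] with t ht
  exact hC t ht

theorem tendsto_logI : Tendsto (fun t : ℝ => logI t) atBot (𝓝 1) := by
  have h : coeffI 0 = 1 := by simp [coeffI]
  exact h ▸ entireCoeff_coeffI.tendsto_expSeries

/-- The behaviour of `K₀` at the origin. -/
theorem tendsto_logK_add : Tendsto (fun t : ℝ => logK t + t) atBot
    (𝓝 ((Real.log 2 : ℂ) - Real.eulerMascheroniConstant)) := by
  have hS : Tendsto (fun t : ℝ => expSeries coeffS t) atBot (𝓝 0) := by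
    have := entireCoeff_coeffS.tendsto_expSeries
    simpa [coeffS] using this
  have htI : Tendsto (fun t : ℝ => (t : ℂ) * (logI t - 1)) atBot (𝓝 0) := by
    obtain ⟨C, hC⟩ := entireCoeff_coeffI.norm_expSeries_sub_le
    have hb : Tendsto (fun t : ℝ => ‖C * (t * Real.exp (2 * t))‖) atBot (𝓝 0) := by
      have := (tendsto_mul_exp_two_mul_atBot.const_mul C).norm
      rwa [mul_zero, norm_zero] at this
    refine squeeze_zero_norm' ?_ hb
    filter_upwards [eventually_le_atBot 0] with t ht
    have h0 : coeffI 0 = 1 := by simp [coeffI]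
    have h := hC t ht
    rw [h0] at h
    have h2 := h.trans (le_abs_self _)
    rw [norm_mul, norm_real]
    calc ‖t‖ * ‖logI t - 1‖ ≤ ‖t‖ * |C * Real.exp (2 * t)| := by gcongr; exact h2
      _ = ‖C * (t * Real.exp (2 * t))‖ := by
        rw [← Real.norm_eq_abs, ← norm_mul, mul_left_comm]
  have h := ((tendsto_logI.const_mul ((Real.log 2 : ℂ) - Real.eulerMascheroniConstant)).sub
    htI).add hS
  simp only [mul_one, sub_zero, add_zero] at h
  refine h.congr fun t => ?_
  rw [logK]
  ring

/-- `K₀(x) = ∫ e ^ (-x (s + 1)) / √(s (s + 2)) ds` for small positive `x`: both sides solve the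
modified Bessel equation and behave alike at the origin. -/
theorem eventually_logK_eq_intK : ∀ᶠ t : ℝ in atBot, logK t = intK (Real.exp t : ℝ) := by
  have h := eventually_eq_zero_of_tendsto
    (f := fun t : ℝ => logK t - intK (Real.exp t : ℝ))
    (f' := fun t : ℝ => deriv logK t - intKDeriv t) (b := fun t : ℝ => logI t)
    (b' := fun t : ℝ => deriv logI t) (q := fun t : ℝ => (Real.exp t : ℂ) ^ 2)
    (fun t => (differentiable_logK t).hasDerivAt.comp_ofReal.sub (hasDerivAt_intK t))
    (fun t => by
      refine ((hasDerivAt_deriv_logK t).comp_ofReal.sub (hasDerivAt_intKDeriv t)).congr_deriv ?_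
      rw [mul_sub]
      congr 2
      rw [ofReal_exp, ← exp_nat_mul]
      norm_num)
    (fun t => (differentiable_logI t).hasDerivAt.comp_ofReal)
    (fun t => by
      refine (hasDerivAt_deriv_logI t).comp_ofReal.congr_deriv ?_
      congr 1
      rw [ofReal_exp, ← exp_nat_mul]
      norm_num) tendsto_logI ?_
  · filter_upwards [h] with t ht
    exact sub_eq_zero.mp ht
  · have h1 : Tendsto (fun t : ℝ => realK (Real.exp t) + t) atBot
        (𝓝 (Real.log 2 - Real.eulerMascheroniConstant)) := by
      have he : Tendsto Real.exp atBot (𝓝[>] 0) := Real.tendsto_exp_atBot_nhdsGT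
      refine (tendsto_realK_add_log.comp he).congr fun t => ?_
      simp
    have h2 := (Complex.continuous_ofReal.tendsto _).comp h1
    have h3 := tendsto_logK_add.sub h2
    push_cast at h3
    rw [sub_self] at h3
    refine h3.congr fun t => ?_
    simp only [Function.comp]
    rw [intK_ofReal]
    push_cast
    ring

theorem cos_pos_of_abs_lt {t : ℝ} (h : |t| < Real.pi / 2) : 0 < Real.cos t :=
  Real.cos_pos_of_mem_Ioo ⟨by linarith [neg_abs_le t], by linarith [le_abs_self t]⟩

theorem exp_re_pos {ξ : ℂ} (h : |ξ.im| < Real.pi / 2) : 0 < (exp ξ).re := by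
  rw [exp_re]
  exact mul_pos (Real.exp_pos _) (cos_pos_of_abs_lt h)

/-- The integral representation of `K₀` in the right half plane. -/
theorem logK_eq_intK {ξ : ℂ} (h : |ξ.im| < Real.pi / 2) : logK ξ = intK (exp ξ) := by
  refine eqOn_strip (f := logK) (g := fun ξ => intK (exp ξ)) (θ := 0) (r := Real.pi / 2)
    (by positivity) differentiable_logK.differentiableOn ?_ ?_ (by simpa using h)
  · intro w hw
    have hw : |w.im| < Real.pi / 2 := by simpa using hw
    exact (((laplaceWeight_inv_rho.hasDerivAt (exp_re_pos hw)).comp w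
      (hasDerivAt_exp w)).differentiableAt).differentiableWithinAt
  · filter_upwards [eventually_logK_eq_intK] with t ht
    simpa using ht

end Smyth

/-! ### Rotation of the ray and the asymptotics of `K₀` -/

namespace Smyth

open Complex Filter Topology MeasureTheory Set

/-- The principal branch of `(2 + w) ^ (-1 / 2)`. -/
noncomputable def invSqrt (w : ℂ) : ℂ := (2 + w) ^ ((-(1 / 2) : ℝ) : ℂ)

/-- The derivative of `invSqrt`. -/
noncomputable def invSqrtDeriv (w : ℂ) : ℂ :=
  ((-(1 / 2) : ℝ) : ℂ) * (2 + w) ^ ((-(3 / 2) : ℝ) : ℂ)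

/-- A closed cone with apex `0` that omits the negative real axis if `κ < 1`. -/
def cone (κ : ℝ) : Set ℂ := {w | -(κ * ‖w‖) ≤ w.re}

theorem ofReal_mul_mem_cone {κ : ℝ} {w : ℂ} (hw : w ∈ cone κ) {v : ℝ} (hv : 0 ≤ v) :
    (v : ℂ) * w ∈ cone κ := by
  have hw : -(κ * ‖w‖) ≤ w.re := hw
  change -(κ * ‖(v : ℂ) * w‖) ≤ ((v : ℂ) * w).re
  rw [norm_mul, norm_real, Real.norm_of_nonneg hv, re_ofReal_mul]
  nlinarith

theorem two_add_mem_slitPlane {κ : ℝ} (hκ : κ < 1) {w : ℂ} (hw : w ∈ cone κ) :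
    2 + w ∈ slitPlane := by
  have hw : -(κ * ‖w‖) ≤ w.re := hw
  rw [mem_slitPlane_iff]
  by_cases him : w.im = 0
  · left
    have hn : ‖w‖ = |w.re| := by
      rw [show w = (w.re : ℂ) from Complex.ext rfl (by simpa using him), norm_real, ofReal_re,
        Real.norm_eq_abs]
    rw [hn] at hw
    rcases le_or_gt 0 w.re with h | h
    · simp; linarith
    · rw [abs_of_neg h] at hw
      nlinarith
  · right
    simpa using him

theorem le_norm_two_add {κ : ℝ} (hκ0 : 0 ≤ κ) (hκ : κ < 1) {w : ℂ} (hw : w ∈ cone κ) :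
    2 * Real.sqrt (1 - κ ^ 2) ≤ ‖2 + w‖ := by
  have hw : -(κ * ‖w‖) ≤ w.re := hw
  have h1 : ‖2 + w‖ ^ 2 = 4 + 4 * w.re + ‖w‖ ^ 2 := by
    rw [← normSq_eq_norm_sq, ← normSq_eq_norm_sq, normSq_apply, normSq_apply]
    simp
    ring
  have h2 : (2 * Real.sqrt (1 - κ ^ 2)) ^ 2 = 4 * (1 - κ ^ 2) := by
    rw [mul_pow, Real.sq_sqrt (by nlinarith)]; norm_num
  refine le_of_sq_le_sq ?_ (norm_nonneg _)
  rw [h1, h2]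
  nlinarith [sq_nonneg (‖w‖ - 2 * κ)]

theorem exists_invSqrt_bound {κ : ℝ} (hκ0 : 0 ≤ κ) (hκ : κ < 1) :
    ∃ M, 0 ≤ M ∧ ∀ w ∈ cone κ, ‖invSqrt w‖ ≤ M ∧ ‖invSqrtDeriv w‖ ≤ M ∧
      HasDerivAt invSqrt (invSqrtDeriv w) w := by
  set c := 2 * Real.sqrt (1 - κ ^ 2)
  have hc : 0 < c := by
    have : 0 < 1 - κ ^ 2 := by nlinarith
    positivity
  refine ⟨max (c ^ (-(1 / 2) : ℝ)) (1 / 2 * c ^ (-(3 / 2) : ℝ)), by positivity, fun w hw => ?_⟩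
  have hle : c ≤ ‖2 + w‖ := le_norm_two_add hκ0 hκ hw
  refine ⟨le_max_of_le_left ?_, le_max_of_le_right ?_, ?_⟩
  · rw [invSqrt, norm_cpow_real]
    exact Real.rpow_le_rpow_of_nonpos hc hle (by norm_num)
  · rw [invSqrtDeriv, norm_mul, norm_cpow_real, norm_real]
    have : ‖(-(1 / 2) : ℝ)‖ = 1 / 2 := by norm_num
    rw [this]
    gcongr 1 / 2 * ?_
    exact Real.rpow_le_rpow_of_nonpos hc hle (by norm_num)
  · have h := ((hasDerivAt_id w).const_add 2).cpow_const (c := ((-(1 / 2) : ℝ) : ℂ))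
      (two_add_mem_slitPlane hκ hw)
    refine h.congr_deriv ?_
    rw [invSqrtDeriv]
    simp only [id, mul_one]
    congr 2
    push_cast
    ring

theorem norm_invSqrt_sub_le {κ M : ℝ}
    (hM : ∀ w ∈ cone κ, ‖invSqrt w‖ ≤ M ∧ ‖invSqrtDeriv w‖ ≤ M ∧
      HasDerivAt invSqrt (invSqrtDeriv w) w) {w : ℂ} (hw : w ∈ cone κ) :
    ‖invSqrt w - invSqrt 0‖ ≤ M * ‖w‖ := by
  have h := norm_image_sub_le_of_norm_deriv_le_segment_01'
    (f := fun t : ℝ => invSqrt (t * w)) (f' := fun t => invSqrtDeriv (t * w) * w) (C := M * ‖w‖)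
    (fun t ht => by
      have h1 : HasDerivAt (fun t : ℝ => (t : ℂ) * w) (1 * w) t :=
        ((hasDerivAt_id t).ofReal_comp).mul_const w
      have := (hM _ (ofReal_mul_mem_cone hw ht.1)).2.2.comp t h1
      rw [one_mul] at this
      exact this.hasDerivWithinAt)
    (fun t ht => by
      rw [norm_mul]
      gcongr
      exact (hM _ (ofReal_mul_mem_cone hw ht.1)).2.1)
  simpa using h

/-- The integral `∫ e ^ (-u) u ^ (-1 / 2) (2 + u / x) ^ (-1 / 2) du = √x e ^ x K₀(x)` along the ray
`arg u = θ`, up to a constant factor and with `ζ = e ^ (i θ) / x`. -/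
noncomputable def rayInt (θ : ℝ) (ζ : ℂ) : ℂ :=
  ∫ v in Ioi (0 : ℝ), exp (-exp (θ * I) * v) * ((v ^ (-(1 / 2) : ℝ) : ℝ) : ℂ) * invSqrt (v * ζ)

theorem norm_exp_neg_exp_mul (θ v : ℝ) :
    ‖exp (-exp (θ * I) * v)‖ = Real.exp (-(Real.cos θ * v)) := by
  rw [norm_exp]
  congr 1
  rw [← neg_mul, re_mul_ofReal, neg_re, exp_ofReal_mul_I_re]

theorem measurable_rayInt_kernel (θ : ℝ) : Measurable fun v : ℝ =>
    exp (-exp (θ * I) * v) * ((v ^ (-(1 / 2) : ℝ) : ℝ) : ℂ) := by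
  fun_prop

theorem measurable_invSqrt : Measurable invSqrt := by
  unfold invSqrt
  fun_prop

theorem measurable_invSqrtDeriv : Measurable invSqrtDeriv := by
  unfold invSqrtDeriv
  fun_prop

theorem integrable_rayInt {θ : ℝ} (hθ : |θ| < Real.pi / 2) {κ : ℝ} (hκ0 : 0 ≤ κ) (hκ : κ < 1)
    {ζ : ℂ} (hζ : ζ ∈ cone κ) :
    Integrable (fun v : ℝ => exp (-exp (θ * I) * v) * ((v ^ (-(1 / 2) : ℝ) : ℝ) : ℂ) *
      invSqrt (v * ζ)) (volume.restrict (Ioi 0)) := by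
  obtain ⟨M, hM0, hM⟩ := exists_invSqrt_bound hκ0 hκ
  refine ((laplaceWeight_rpow _ (cos_pos_of_abs_lt hθ)).mul_const M).mono'
    ((measurable_rayInt_kernel θ).mul
      (measurable_invSqrt.comp (by fun_prop))).aestronglyMeasurable ?_
  refine (ae_restrict_iff' measurableSet_Ioi).2 (.of_forall fun v hv => ?_)
  have hv : 0 < v := hv
  rw [norm_mul, norm_mul, norm_exp_neg_exp_mul, norm_real,
    Real.norm_of_nonneg (Real.rpow_nonneg hv.le _)]
  gcongr
  exact (hM _ (ofReal_mul_mem_cone hζ hv.le)).1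

theorem exists_cone_nhds {ζ : ℂ} (hζ : ζ ∈ slitPlane) :
    ∃ κ, 0 ≤ κ ∧ κ < 1 ∧ cone κ ∈ 𝓝 ζ := by
  have hpos : 0 < ‖ζ‖ := norm_pos_iff.mpr (slitPlane_ne_zero hζ)
  have hre : -‖ζ‖ < ζ.re := by
    rw [mem_slitPlane_iff_not_le_zero] at hζ
    by_contra! h
    apply hζ
    have h1 : |ζ.re| ≤ ‖ζ‖ := abs_re_le_norm ζ
    have h2 : ζ.re = -‖ζ‖ := le_antisymm h (neg_le_of_abs_le h1)
    have h3 : |ζ.re| = ‖ζ‖ := by rw [h2, abs_neg, abs_norm]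
    rw [Complex.le_def]
    exact ⟨by simp [h2], by simpa using (abs_re_eq_norm.mp h3)⟩
  obtain ⟨κ, h1, h2⟩ := exists_between (show max 0 (-ζ.re / ‖ζ‖) < 1 by
    rw [max_lt_iff, div_lt_one hpos]; exact ⟨one_pos, by linarith⟩)
  rw [max_lt_iff, div_lt_iff₀ hpos] at h1
  refine ⟨κ, h1.1.le, h2, ?_⟩
  have hopen : IsOpen {w : ℂ | -(κ * ‖w‖) < w.re} := isOpen_lt (by fun_prop) continuous_re
  filter_upwards [hopen.mem_nhds (show -(κ * ‖ζ‖) < ζ.re by linarith)] with w hw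
  exact le_of_lt hw

theorem differentiableAt_rayInt {θ : ℝ} (hθ : |θ| < Real.pi / 2) {ζ : ℂ} (hζ : ζ ∈ slitPlane) :
    DifferentiableAt ℂ (rayInt θ) ζ := by
  obtain ⟨κ, hκ0, hκ, hU⟩ := exists_cone_nhds hζ
  obtain ⟨M, hM0, hM⟩ := exists_invSqrt_bound hκ0 hκ
  refine (hasDerivAt_integral_of_dominated_loc_of_deriv_le (μ := volume.restrict (Ioi (0 : ℝ)))
    (F := fun (ζ : ℂ) (v : ℝ) => exp (-exp (θ * I) * v) * ((v ^ (-(1 / 2) : ℝ) : ℝ) : ℂ) *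
      invSqrt (v * ζ))
    (F' := fun (ζ : ℂ) (v : ℝ) => exp (-exp (θ * I) * v) * ((v ^ (-(1 / 2) : ℝ) : ℝ) : ℂ) *
      (invSqrtDeriv (v * ζ) * v))
    (bound := fun v => Real.exp (-(Real.cos θ * v)) * ((v + 1) * v ^ (-(1 / 2) : ℝ)) * M)
    hU (.of_forall fun w => ((measurable_rayInt_kernel θ).mul
      (measurable_invSqrt.comp (by fun_prop))).aestronglyMeasurable)
    (integrable_rayInt hθ hκ0 hκ (mem_of_mem_nhds hU))
    ((measurable_rayInt_kernel θ).mul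
      ((measurable_invSqrtDeriv.comp (by fun_prop)).mul (by fun_prop))).aestronglyMeasurable
    ?_ ((laplaceWeight_rpow.add_one_mul _ (cos_pos_of_abs_lt hθ)).mul_const M) ?_).2.differentiableAt
  · refine (ae_restrict_iff' measurableSet_Ioi).2 (.of_forall fun v hv w hw => ?_)
    have hv : 0 < v := hv
    have hp := Real.rpow_nonneg hv.le (-(1 / 2))
    rw [norm_mul, norm_mul, norm_mul, norm_exp_neg_exp_mul, norm_real, norm_real,
      Real.norm_of_nonneg hp, Real.norm_of_nonneg hv.le]
    have hb := (hM _ (ofReal_mul_mem_cone hw hv.le)).2.1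
    calc _ ≤ Real.exp (-(Real.cos θ * v)) * v ^ (-(1 / 2) : ℝ) * (M * (v + 1)) := by
          gcongr
          linarith
      _ = _ := by ring
  · refine (ae_restrict_iff' measurableSet_Ioi).2 (.of_forall fun v hv w hw => ?_)
    have hv : 0 < v := hv
    have h1 : HasDerivAt (fun w : ℂ => (v : ℂ) * w) (v * 1) w := (hasDerivAt_id w).const_mul _
    rw [mul_one] at h1
    exact ((hM _ (ofReal_mul_mem_cone hw hv.le)).2.2.comp w h1).const_mul _

/-- The value of `rayInt` at `ζ = 0`, i.e. `x = ∞`, is approached with an error `O(ζ)`, uniformly in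
a closed cone that avoids the cut. -/
theorem exists_norm_rayInt_sub_le {θ : ℝ} (hθ : |θ| < Real.pi / 2) {κ : ℝ} (hκ0 : 0 ≤ κ)
    (hκ : κ < 1) : ∃ B, 0 ≤ B ∧ ∀ ζ ∈ cone κ, ‖rayInt θ ζ - rayInt θ 0‖ ≤ B * ‖ζ‖ := by
  obtain ⟨M, hM0, hM⟩ := exists_invSqrt_bound hκ0 hκ
  have hi := (laplaceWeight_rpow.add_one_mul _ (cos_pos_of_abs_lt hθ)).mul_const M
  refine ⟨∫ v in Ioi (0 : ℝ), Real.exp (-(Real.cos θ * v)) * ((v + 1) * v ^ (-(1 / 2) : ℝ)) * M,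
    setIntegral_nonneg measurableSet_Ioi fun v hv => ?_, fun ζ hζ => ?_⟩
  · have hv : 0 < v := hv
    positivity
  · unfold rayInt
    rw [← integral_sub (integrable_rayInt hθ hκ0 hκ hζ)
      (integrable_rayInt hθ hκ0 hκ (by simp [cone])), ← integral_mul_const]
    refine norm_integral_le_of_norm_le (hi.mul_const _) ?_
    refine (ae_restrict_iff' measurableSet_Ioi).2 (.of_forall fun v hv => ?_)
    have hv : 0 < v := hv
    have hp := Real.rpow_nonneg hv.le (-(1 / 2))
    rw [← mul_sub, norm_mul, norm_mul, norm_exp_neg_exp_mul, norm_real, Real.norm_of_nonneg hp,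
      mul_zero]
    have hb := norm_invSqrt_sub_le hM (ofReal_mul_mem_cone hζ hv.le)
    rw [norm_mul, norm_real, Real.norm_of_nonneg hv.le] at hb
    calc _ ≤ Real.exp (-(Real.cos θ * v)) * v ^ (-(1 / 2) : ℝ) * (M * ((v + 1) * ‖ζ‖)) := by
          gcongr
          refine hb.trans ?_
          gcongr
          linarith
      _ = _ := by ring

/-- `rayInt 0 0 = Γ(1 / 2) / √2`. -/
theorem rayInt_zero_zero : rayInt 0 0 = (Real.sqrt (Real.pi / 2) : ℂ) := by
  have h := Real.Gamma_eq_integral (s := 1 / 2) (by norm_num)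
  rw [Real.Gamma_one_half_eq] at h
  have h2 : invSqrt 0 = ((2 ^ (-(1 / 2) : ℝ) : ℝ) : ℂ) := by
    rw [invSqrt, add_zero, ofReal_cpow (by norm_num)]
    norm_num
  unfold rayInt
  simp only [mul_zero, h2]
  rw [integral_mul_const]
  have h3 : (∫ v in Ioi (0 : ℝ), exp (-exp ((0 : ℝ) * I) * v) *
      ((v ^ (-(1 / 2) : ℝ) : ℝ) : ℂ)) = (Real.sqrt Real.pi : ℂ) := by
    rw [h, ← integral_complex_ofReal]
    refine integral_congr_ae (.of_forall fun v => ?_)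
    norm_num
  rw [h3, Real.sqrt_div Real.pi_pos.le, Real.rpow_neg (by norm_num), ← Real.sqrt_eq_rpow]
  push_cast
  rw [div_eq_mul_inv]

/-- `√x e ^ x K₀(x)` in the logarithmic coordinate. -/
noncomputable def scaledK (ξ : ℂ) : ℂ := exp (ξ / 2) * exp (exp ξ) * logK ξ

theorem differentiable_scaledK : Differentiable ℂ scaledK := by
  unfold scaledK
  have := differentiable_logK
  fun_prop

theorem exp_mul_intK (x : ℂ) :
    exp x * intK x = ∫ s in Ioi (0 : ℝ), exp (-x * s) * (((rho s)⁻¹ : ℝ) : ℂ) := by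
  unfold intK laplace
  rw [← integral_const_mul]
  refine integral_congr_ae (.of_forall fun s => ?_)
  simp only
  rw [← mul_assoc, ← exp_add]
  ring_nf

/-- On the ray `arg x = θ` the substitution `v = |x| s` identifies the two integrals. -/
theorem scaledK_eq_on_line {θ : ℝ} (hθ : |θ| < Real.pi / 2) (t : ℝ) :
    scaledK (t + θ * I) = exp (θ * I / 2) * rayInt θ (exp (θ * I - (t + θ * I))) := by
  have hz : exp ((θ : ℂ) * I - (t + θ * I)) = ((Real.exp (-t) : ℝ) : ℂ) := by
    push_cast; congr 1; ring
  have hsub := integral_comp_mul_left_Ioi' (fun v : ℝ => exp (-exp (θ * I) * v) *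
    ((v ^ (-(1 / 2) : ℝ) : ℝ) : ℂ) * invSqrt (v * ((Real.exp (-t) : ℝ) : ℂ))) 0 (Real.exp_pos t)
  rw [mul_zero] at hsub
  have he : ∀ s ∈ Ioi (0 : ℝ), exp (-exp (θ * I) * ((Real.exp t * s : ℝ) : ℂ)) *
      (((Real.exp t * s) ^ (-(1 / 2) : ℝ) : ℝ) : ℂ) *
      invSqrt (((Real.exp t * s : ℝ) : ℂ) * ((Real.exp (-t) : ℝ) : ℂ)) =
      ((Real.exp (-(t / 2)) : ℝ) : ℂ) *
        (exp (-exp (t + θ * I) * s) * (((rho s)⁻¹ : ℝ) : ℂ)) := by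
    intro s hs
    have hs : 0 < s := hs
    have h1 : ((Real.exp t * s : ℝ) : ℂ) * ((Real.exp (-t) : ℝ) : ℂ) = s := by
      rw [← ofReal_mul, mul_right_comm, ← Real.exp_add]; simp
    have h2 : invSqrt (s : ℂ) = (((2 + s) ^ (-(1 / 2) : ℝ) : ℝ) : ℂ) := by
      rw [invSqrt, ofReal_cpow (by positivity)]; push_cast; rfl
    have h3 : (Real.exp t * s) ^ (-(1 / 2) : ℝ) = Real.exp (-(t / 2)) * s ^ (-(1 / 2) : ℝ) := by
      rw [Real.mul_rpow (Real.exp_pos _).le hs.le, ← Real.exp_mul]; ring_nf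
    have h4 : (rho s)⁻¹ = s ^ (-(1 / 2) : ℝ) * (2 + s) ^ (-(1 / 2) : ℝ) := by
      rw [← Real.mul_rpow hs.le (by positivity), Real.rpow_neg (by positivity),
        ← Real.sqrt_eq_rpow, rho, add_comm s 2]
    have h5 : -exp (θ * I) * ((Real.exp t * s : ℝ) : ℂ) = -exp (t + θ * I) * s := by
      rw [exp_add]; push_cast; ring
    rw [h1, h2, h3, h4, h5]
    push_cast
    ring
  rw [setIntegral_congr_fun measurableSet_Ioi he, integral_const_mul, ← exp_mul_intK,
    ← logK_eq_intK (by simpa using hθ)] at hsub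
  rw [hz, rayInt, ← hsub, scaledK]
  have e1 : exp ((t + θ * I) / 2) = exp (θ * I / 2) * exp ((t : ℂ) / 2) := by
    rw [← exp_add]; ring_nf
  have e2 : (Real.exp t • ((Real.exp (-(t / 2)) : ℝ) : ℂ)) = exp ((t : ℂ) / 2) := by
    rw [real_smul, ← ofReal_mul, ← Real.exp_add]
    push_cast
    ring_nf
  rw [e1, ← e2]
  simp only [real_smul]
  ring

theorem exp_mem_slitPlane {ξ : ℂ} (h : |ξ.im| < Real.pi) : exp ξ ∈ slitPlane := by
  rw [mem_slitPlane_iff_arg]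
  refine ⟨?_, exp_ne_zero _⟩
  rw [arg_exp, (toIocMod_eq_self _).mpr ⟨by linarith [neg_abs_le ξ.im],
    by linarith [le_abs_self ξ.im]⟩]
  linarith [le_abs_self ξ.im]

/-- Rotating the ray of integration by `θ` continues the integral representation to
`|arg x - θ| < π`. -/
theorem scaledK_eq_rayInt {θ : ℝ} (hθ : |θ| < Real.pi / 2) {ξ : ℂ} (hξ : |ξ.im - θ| < Real.pi) :
    scaledK ξ = exp (θ * I / 2) * rayInt θ (exp (θ * I - ξ)) := by
  refine eqOn_strip (f := scaledK) (g := fun ξ => exp (θ * I / 2) * rayInt θ (exp (θ * I - ξ)))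
    Real.pi_pos differentiable_scaledK.differentiableOn ?_
    (.of_forall (scaledK_eq_on_line hθ)) hξ
  intro w hw
  have hw : |w.im - θ| < Real.pi := hw
  have h1 : exp (θ * I - w) ∈ slitPlane := by
    refine exp_mem_slitPlane ?_
    rw [abs_sub_comm] at hw
    simpa using hw
  have h2 : DifferentiableAt ℂ (fun w : ℂ => exp (θ * I - w)) w := by fun_prop
  exact ((DifferentiableAt.comp w (differentiableAt_rayInt hθ h1) h2).const_mul
    _).differentiableWithinAt

theorem exp_mem_cone {κ : ℝ} {ξ : ℂ} (h : -κ ≤ Real.cos ξ.im) : exp ξ ∈ cone κ := by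
  change -(κ * ‖exp ξ‖) ≤ (exp ξ).re
  rw [norm_exp, exp_re]
  nlinarith [Real.exp_pos ξ.re]

theorem tendsto_scaledK {θ : ℝ} (hθ : |θ| < Real.pi / 2) :
    Tendsto (fun t : ℝ => scaledK t) atTop (𝓝 (exp (θ * I / 2) * rayInt θ 0)) := by
  obtain ⟨B, _, hB⟩ := exists_norm_rayInt_sub_le hθ le_rfl one_pos
  have h : Tendsto (fun t : ℝ => rayInt θ (exp (θ * I - t))) atTop (𝓝 (rayInt θ 0)) := by
    rw [tendsto_iff_norm_sub_tendsto_zero]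
    have h0 : Tendsto (fun t : ℝ => B * Real.exp (-t)) atTop (𝓝 0) := by
      have := (Real.tendsto_exp_atBot.comp tendsto_neg_atTop_atBot).const_mul B
      rwa [mul_zero] at this
    refine squeeze_zero (fun _ => norm_nonneg _) (fun t => ?_) h0
    have h1 : exp (θ * I - t) ∈ cone 0 := by
      refine exp_mem_cone ?_
      simpa using (cos_pos_of_abs_lt hθ).le
    have h2 := hB _ h1
    rw [norm_exp] at h2
    simpa using h2
  refine (h.const_mul _).congr fun t => ?_
  rw [scaledK_eq_rayInt hθ]
  simp only [ofReal_im, zero_sub, abs_neg]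
  linarith [Real.pi_pos]

/-- The leading constant does not depend on the ray, since all rays describe the same function on
the positive axis. -/
theorem exp_mul_rayInt_zero {θ : ℝ} (hθ : |θ| < Real.pi / 2) :
    exp (θ * I / 2) * rayInt θ 0 = (Real.sqrt (Real.pi / 2) : ℂ) := by
  have h0 := tendsto_scaledK (θ := 0) (by simpa using Real.pi_pos)
  rw [tendsto_nhds_unique (tendsto_scaledK hθ) h0, rayInt_zero_zero]
  simp

/-- The ray `arg u = θ` gives the asymptotics in `|arg x - θ| ≤ π - δ`. -/
theorem exists_norm_scaledK_sub_le {θ δ : ℝ} (hθ : |θ| < Real.pi / 2) (hδ : 0 < δ)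
    (hδπ : δ < Real.pi) : ∃ B, 0 ≤ B ∧ ∀ ξ : ℂ, |ξ.im - θ| ≤ Real.pi - δ →
      ‖scaledK ξ - Real.sqrt (Real.pi / 2)‖ ≤ B * Real.exp (-ξ.re) := by
  have hsin := Real.sin_pos_of_pos_of_lt_pi hδ hδπ
  have hκ : |Real.cos δ| < 1 := by
    rw [← sq_lt_one_iff_abs_lt_one]
    nlinarith [Real.sin_sq_add_cos_sq δ]
  obtain ⟨B, hB0, hB⟩ := exists_norm_rayInt_sub_le hθ (abs_nonneg _) hκ
  refine ⟨B, hB0, fun ξ hξ => ?_⟩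
  have hmem : exp (θ * I - ξ) ∈ cone |Real.cos δ| := by
    refine exp_mem_cone ?_
    have h1 : (θ * I - ξ).im = -(ξ.im - θ) := by simp
    rw [h1, Real.cos_neg, ← Real.cos_abs (ξ.im - θ)]
    have h2 := Real.cos_le_cos_of_nonneg_of_le_pi (abs_nonneg _)
      (by linarith : Real.pi - δ ≤ Real.pi) hξ
    rw [Real.cos_pi_sub] at h2
    linarith [le_abs_self (Real.cos δ)]
  have h := hB _ hmem
  rw [scaledK_eq_rayInt hθ (by linarith), ← exp_mul_rayInt_zero hθ, ← mul_sub, norm_mul]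
  have h3 : ‖exp ((θ : ℂ) * I / 2)‖ = 1 := by
    rw [show (θ : ℂ) * I / 2 = ((θ / 2 : ℝ) : ℂ) * I by push_cast; ring, norm_exp_ofReal_mul_I]
  rw [h3, one_mul]
  rw [norm_exp] at h
  simpa using h

/-- The large argument asymptotics of `K₀` in `|arg x| ≤ 3π / 2 - δ`. -/
theorem exists_norm_normK_sub_le {δ : ℝ} (hδ : 0 < δ) (hδπ : δ < Real.pi) :
    ∃ B, 0 ≤ B ∧ ∀ ξ : ℂ, |ξ.im| ≤ 3 / 2 * Real.pi - δ →
      ‖normK ξ - 1‖ ≤ B * Real.exp (-ξ.re) := by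
  have hp := Real.pi_pos
  have hθ1 : |Real.pi / 2 - δ / 2| < Real.pi / 2 := by
    rw [abs_lt]; constructor <;> linarith
  have hθ2 : |-(Real.pi / 2 - δ / 2)| < Real.pi / 2 := by rwa [abs_neg]
  -- The rays `± (π / 2 - δ / 2)` together cover the whole sector.
  obtain ⟨B1, hB1, h1⟩ := exists_norm_scaledK_sub_le hθ1 (half_pos hδ) (by linarith)
  obtain ⟨B2, hB2, h2⟩ := exists_norm_scaledK_sub_le hθ2 (half_pos hδ) (by linarith)
  have hc : (Real.sqrt (2 / Real.pi) : ℂ) * Real.sqrt (Real.pi / 2) = 1 := by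
    rw [← ofReal_mul, ← Real.sqrt_mul (by positivity), div_mul_div_cancel₀ hp.ne',
      div_self two_ne_zero]
    simp
  refine ⟨Real.sqrt (2 / Real.pi) * max B1 B2, by positivity, fun ξ hξ => ?_⟩
  have e : normK ξ - 1 = Real.sqrt (2 / Real.pi) * (scaledK ξ - Real.sqrt (Real.pi / 2)) := by
    rw [mul_sub, hc, normK, scaledK]; ring
  rw [e, norm_mul, norm_real, Real.norm_of_nonneg (Real.sqrt_nonneg _), mul_assoc]
  gcongr
  rw [abs_le] at hξ
  rcases le_total 0 ξ.im with h | h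
  · refine (h1 ξ ?_).trans ?_
    · rw [abs_le]; constructor <;> linarith
    · gcongr; exact le_max_left _ _
  · refine (h2 ξ ?_).trans ?_
    · rw [abs_le]; constructor <;> linarith
    · gcongr; exact le_max_right _ _

end Smyth

/-! ### The asymptotics of `K` -/

namespace Smyth

open Complex Filter Topology Set

/-- The strip `-3π / 2 + δ ≤ Im ξ ≤ π / 2 - δ` in the logarithmic coordinate. -/
def sector (δ : ℝ) : Set ℂ := {ξ | -(3 / 2 * Real.pi) + δ ≤ ξ.im ∧ ξ.im ≤ Real.pi / 2 - δ}

/-- `1 + T₁ ± i T₂` are the values of `normK` at `ξ` and `ξ + i π`, and `sector δ` is the set of `ξ` for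
which both lie in `|Im| ≤ 3π / 2 - δ`. -/
theorem exists_norm_T_le {δ : ℝ} (hδ : 0 < δ) (hδπ : δ < Real.pi) :
    ∃ B, 0 ≤ B ∧ ∀ ξ ∈ sector δ,
      ‖T1 ξ‖ ≤ B * Real.exp (-ξ.re) ∧ ‖T2 ξ‖ ≤ B * Real.exp (-ξ.re) := by
  obtain ⟨B, hB0, hB⟩ := exists_norm_normK_sub_le hδ hδπ
  have hp := Real.pi_pos
  refine ⟨B, hB0, fun ξ hξ => ?_⟩
  obtain ⟨h1, h2⟩ := hξ
  have b1 := hB ξ (by rw [abs_le]; constructor <;> linarith)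
  have b2 := hB (ξ + I * Real.pi) (by simp only [add_im, mul_im, I_re, I_im, ofReal_re, ofReal_im];
                                      rw [abs_le]; constructor <;> linarith)
  have hre : (ξ + I * Real.pi).re = ξ.re := by simp
  rw [hre] at b2
  constructor
  · have : T1 ξ = ((normK ξ - 1) + (normK (ξ + I * Real.pi) - 1)) / 2 := by rw [T1_eq]; ring
    rw [this, norm_div, norm_ofNat]
    have := norm_add_le (normK ξ - 1) (normK (ξ + I * Real.pi) - 1)
    linarith
  · have : T2 ξ = -I * ((normK ξ - 1) - (normK (ξ + I * Real.pi) - 1)) / 2 := by rw [T2_eq]; ring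
    rw [this, norm_div, norm_mul, norm_neg, norm_I, one_mul, norm_ofNat]
    have := norm_sub_le (normK ξ - 1) (normK (ξ + I * Real.pi) - 1)
    linarith

/-- Cauchy's estimate on a disc of radius `δ / 2`, which stays inside the wider sector. -/
theorem exists_norm_deriv_le {f : ℂ → ℂ} (hf : Differentiable ℂ f) {δ B : ℝ} (hδ : 0 < δ)
    (hB0 : 0 ≤ B) (hB : ∀ ξ ∈ sector (δ / 2), ‖f ξ‖ ≤ B * Real.exp (-ξ.re)) :
    ∃ D, 0 ≤ D ∧ ∀ ξ ∈ sector δ, ‖deriv f ξ‖ ≤ D * Real.exp (-ξ.re) := by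
  refine ⟨B * Real.exp (δ / 2) / (δ / 2), by positivity, fun ξ hξ => ?_⟩
  have h := norm_deriv_le_of_forall_mem_sphere_norm_le (c := ξ) (half_pos hδ)
    (C := B * (Real.exp (δ / 2) * Real.exp (-ξ.re))) hf.diffContOnCl fun w hw => ?_
  · refine h.trans (le_of_eq ?_)
    ring
  · have hw : ‖w - ξ‖ = δ / 2 := by simpa [dist_eq_norm] using hw
    have him := abs_le.mp ((abs_im_le_norm (w - ξ)).trans_eq hw)
    have hre := abs_le.mp ((abs_re_le_norm (w - ξ)).trans_eq hw)
    rw [sub_im] at him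
    rw [sub_re] at hre
    refine (hB w ⟨by linarith [hξ.1], by linarith [hξ.2]⟩).trans ?_
    rw [← Real.exp_add]
    gcongr
    linarith

theorem xi_im (m : ℤ) (z l : ℂ) : (xi m z l).im = 2 * arg z - l.im - m * Real.pi := by
  simp [xi, log_im, mul_im]

theorem exp_neg_xi_re (m : ℤ) {z : ℂ} (hz : z ≠ 0) (l : ℂ) :
    Real.exp (-(xi m z l).re) = 2 * ‖((exp l)⁻¹ * z ^ 2)⁻¹‖ := by
  rw [Real.exp_neg, ← norm_exp, exp_xi m hz, norm_mul, norm_zpow, norm_neg, norm_one, one_zpow,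
    one_mul, norm_inv, ← mul_div_assoc, norm_div, norm_ofNat, inv_div, div_eq_mul_inv]

/-- Since `ξ` depends on `z` through `2 log z`, the derivative in `K` equals `(λ⁻¹ z ^ 2)⁻¹` times a
bounded function. -/
theorem K_zero_one (m : ℤ) {z : ℂ} (hz : z ∈ slitPlane) (l : ℂ) :
    K m z l 0 1 = (-1) ^ (m + 1) * I * T2 (xi m z l) +
      ((exp l)⁻¹ * z ^ 2)⁻¹ * (2 * deriv T1 (xi m z l) - (1 + T1 (xi m z l))) := by
  have hz0 := slitPlane_ne_zero hz
  have h1 : HasDerivAt (fun w => T1 (xi m w l)) (deriv T1 (xi m z l) * (2 / z)) z :=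
    (differentiable_T1 _).hasDerivAt.comp z (hasDerivAt_xi m hz l)
  have hi := hasDerivAt_inv hz0
  have h2 : HasDerivAt (fun w => w⁻¹ + w⁻¹ * T1 (xi m w l)) _ z := hi.add (hi.mul h1)
  have hl := exp_ne_zero l
  simp only [K, h2.deriv, Matrix.of_apply, Matrix.cons_val', Matrix.cons_val_zero,
    Matrix.cons_val_one, Matrix.cons_val_fin_one]
  field_simp
  ring

theorem K_one_one (m : ℤ) {z : ℂ} (hz : z ∈ slitPlane) (l : ℂ) :
    K m z l 1 1 = 1 + T1 (xi m z l) + (-1) ^ (m + 1) * I *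
      (((exp l)⁻¹ * z ^ 2)⁻¹ * (2 * deriv T2 (xi m z l) - T2 (xi m z l))) := by
  have hz0 := slitPlane_ne_zero hz
  have h1 : HasDerivAt (fun w => T2 (xi m w l)) (deriv T2 (xi m z l) * (2 / z)) z :=
    (differentiable_T2 _).hasDerivAt.comp z (hasDerivAt_xi m hz l)
  have hi := hasDerivAt_inv hz0
  have h2 : HasDerivAt (fun w => w⁻¹ * T2 (xi m w l)) _ z := hi.mul h1
  have hl := exp_ne_zero l
  simp only [K, h2.deriv, Matrix.of_apply, Matrix.cons_val',
    Matrix.cons_val_one, Matrix.cons_val_fin_one]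
  field_simp
  ring

theorem norm_neg_one_zpow_mul_I (m : ℤ) : ‖(-1 : ℂ) ^ m * I‖ = 1 := by
  rw [norm_mul, norm_zpow, norm_neg, norm_one, one_zpow, norm_I, one_mul]

theorem exists_norm_K_sub_one_le (m : ℤ) {δ : ℝ} (hδ : 0 < δ) (hδπ : δ < Real.pi) :
    ∃ B, ∀ z l : ℂ, (z, l) ∈ closedSector m δ → 1 ≤ ‖(exp l)⁻¹ * z ^ 2‖ → ∀ i j : Fin 2,
      ‖(K m z l - 1) i j‖ ≤ B * ‖((exp l)⁻¹ * z ^ 2)⁻¹‖ := by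
  obtain ⟨B, hB0, hB⟩ := exists_norm_T_le (half_pos hδ) (by linarith)
  obtain ⟨D1, hD10, hD1⟩ := exists_norm_deriv_le differentiable_T1 hδ hB0 fun ξ hξ => (hB ξ hξ).1
  obtain ⟨D2, hD20, hD2⟩ := exists_norm_deriv_le differentiable_T2 hδ hB0 fun ξ hξ => (hB ξ hξ).2
  refine ⟨1 + 4 * B + 4 * D1 + 4 * D2, fun z l hzl hy => ?_⟩
  obtain ⟨hz, -, h1, h2⟩ := hzl
  simp only at hz h1 h2
  have hmem : xi m z l ∈ sector δ := by
    constructor <;> rw [xi_im] <;> assumption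
  have hmem' : xi m z l ∈ sector (δ / 2) := ⟨by linarith [hmem.1], by linarith [hmem.2]⟩
  have hT := hB _ hmem'
  have hd1 := hD1 _ hmem
  have hd2 := hD2 _ hmem
  rw [exp_neg_xi_re m (slitPlane_ne_zero hz)] at hT hd1 hd2
  obtain ⟨hT1, hT2⟩ := hT
  set r := ‖((exp l)⁻¹ * z ^ 2)⁻¹‖ with hr
  have hr0 : 0 ≤ r := norm_nonneg _
  have hr1 : r ≤ 1 := by rw [hr, norm_inv]; exact inv_le_one_of_one_le₀ hy
  have hBr := mul_nonneg hB0 hr0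
  have hD1r := mul_nonneg hD10 hr0
  have hD2r := mul_nonneg hD20 hr0
  have hs := norm_neg_one_zpow_mul_I (m + 1)
  have hBrr : B * r * r ≤ B * r := mul_le_of_le_one_right hBr hr1
  have hD1rr : D1 * r * r ≤ D1 * r := mul_le_of_le_one_right hD1r hr1
  have hD2rr : D2 * r * r ≤ D2 * r := mul_le_of_le_one_right hD2r hr1
  intro i j
  fin_cases i <;> fin_cases j
  · have e : (K m z l - 1) 0 0 = T1 (xi m z l) := by simp [K]
    change ‖(K m z l - 1) 0 0‖ ≤ _
    rw [e]
    nlinarith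
  · have e : (K m z l - 1) 0 1 = K m z l 0 1 := by simp
    change ‖(K m z l - 1) 0 1‖ ≤ _
    rw [e, K_zero_one m hz]
    refine (norm_add_le _ _).trans ?_
    rw [norm_mul, hs, one_mul, norm_mul, ← hr]
    have h3 : ‖2 * deriv T1 (xi m z l) - (1 + T1 (xi m z l))‖ ≤
        2 * (D1 * (2 * r)) + (1 + B * (2 * r)) := by
      refine (norm_sub_le _ _).trans (add_le_add ?_ ((norm_add_le _ _).trans ?_))
      · rw [norm_mul, norm_ofNat]; gcongr
      · rw [norm_one]; gcongr
    have h4 := mul_le_mul_of_nonneg_left h3 hr0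
    nlinarith
  · have e : (K m z l - 1) 1 0 = (-1) ^ (m + 1) * I * T2 (xi m z l) := by simp [K]
    change ‖(K m z l - 1) 1 0‖ ≤ _
    rw [e, norm_mul, hs, one_mul]
    nlinarith
  · have e : (K m z l - 1) 1 1 = K m z l 1 1 - 1 := by simp
    change ‖(K m z l - 1) 1 1‖ ≤ _
    rw [e, K_one_one m hz, add_assoc, add_sub_cancel_left]
    refine (norm_add_le _ _).trans ?_
    rw [norm_mul, hs, one_mul, norm_mul, ← hr]
    have h3 : ‖2 * deriv T2 (xi m z l) - T2 (xi m z l)‖ ≤ 2 * (D2 * (2 * r)) + B * (2 * r) := by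
      refine (norm_sub_le _ _).trans (add_le_add ?_ hT2)
      rw [norm_mul, norm_ofNat]; gcongr
    have h4 := mul_le_mul_of_nonneg_left h3 hr0
    nlinarith

theorem isBigO_K_sub_one (m : ℤ) {δ : ℝ} (hδ : 0 < δ) (i j : Fin 2) :
    Asymptotics.IsBigO (atInftySector m δ) (fun p : ℂ × ℂ => (K m p.1 p.2 - 1) i j)
      (fun p : ℂ × ℂ => ((exp p.2)⁻¹ * p.1 ^ 2)⁻¹) := by
  -- The uniform bound needs `δ < π`; a smaller `δ` only enlarges the sector.
  obtain ⟨B, hB⟩ := exists_norm_K_sub_one_le m (δ := min δ 1) (by positivity)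
    ((min_le_right _ _).trans_lt (by linarith [Real.pi_gt_three]))
  refine .of_bound B ?_
  have h1 : ∀ᶠ p : ℂ × ℂ in atInftySector m δ, 1 ≤ ‖(exp p.2)⁻¹ * p.1 ^ 2‖ :=
    (tendsto_comap.mono_left inf_le_left).eventually_ge_atTop 1
  have h2 : ∀ᶠ p : ℂ × ℂ in atInftySector m δ, p ∈ closedSector m δ :=
    (eventually_mem_principal _).filter_mono inf_le_right
  filter_upwards [h1, h2] with p hp1 hp2
  refine hB p.1 p.2 ⟨hp2.1, hp2.2.1, ?_, ?_⟩ hp1 i j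
  · exact le_trans (by linarith [min_le_left δ 1]) hp2.2.2.1
  · exact hp2.2.2.2.trans (by linarith [min_le_left δ 1])

theorem tendsto_inv_atInftySector (m : ℤ) (δ : ℝ) :
    Tendsto (fun p : ℂ × ℂ => ((exp p.2)⁻¹ * p.1 ^ 2)⁻¹) (atInftySector m δ) (𝓝 0) := by
  rw [tendsto_zero_iff_norm_tendsto_zero]
  have h : Tendsto (fun p : ℂ × ℂ => ‖(exp p.2)⁻¹ * p.1 ^ 2‖) (atInftySector m δ) atTop :=
    tendsto_comap.mono_left inf_le_left
  refine (tendsto_inv_atTop_zero.comp h).congr fun p => ?_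
  simp

theorem tendsto_K (m : ℤ) {δ : ℝ} (hδ : 0 < δ) :
    Tendsto (fun p : ℂ × ℂ => K m p.1 p.2) (atInftySector m δ) (𝓝 1) := by
  refine tendsto_pi_nhds.mpr fun i => tendsto_pi_nhds.mpr fun j => ?_
  have h := (isBigO_K_sub_one m hδ i j).trans_tendsto (tendsto_inv_atInftySector m δ)
  have h2 := h.add_const ((1 : Matrix (Fin 2) (Fin 2) ℂ) i j)
  rw [zero_add] at h2
  refine h2.congr fun p => ?_
  simp

end Smyth

theorem proposition4p3 (m : ℤ) :
    (∀ a : ℝ, 0 < a → ∀ z ∈ Complex.slitPlane, ∀ l ∈ Smyth.Omega m,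
      Smyth.phi a z (Complex.exp l) =
        Smyth.H a l * Smyth.A a m l * Smyth.phi0 z l * Smyth.K m z l * Smyth.C z) ∧
    (∀ δ : ℝ, 0 < δ →
      Filter.Tendsto (fun p : ℂ × ℂ => Smyth.K m p.1 p.2) (Smyth.atInftySector m δ) (nhds 1) ∧
      ∀ i j : Fin 2, Asymptotics.IsBigO (Smyth.atInftySector m δ)
        (fun p : ℂ × ℂ => (Smyth.K m p.1 p.2 - 1) i j)
        (fun p : ℂ × ℂ => ((Complex.exp p.2)⁻¹ * p.1 ^ 2)⁻¹)) :=
  ⟨fun _ ha _ hz l _ => Smyth.phi_eq ha m hz l,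
    fun _ hδ => ⟨Smyth.tendsto_K m hδ, Smyth.isBigO_K_sub_one m hδ⟩⟩
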